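/- For a positive integer $n$, let $p(n)$ denote the number of partitions of $n$. The hook of a box $b$ in the Young diagram of a partition consists of $b$ together with all the boxes of the diagram directly to its right and directly below it; its length is the number of boxes in it. For a positive integer $t$, a partition is called a $t$-core if its Young diagram contains no hook of length $t$. There is an absolute constant $C>0$ such that the following holds. Let $n\ge 3$ be an integer, let $L$ be a real number with $1\le L\le \frac{\log n}{\log\log n}$, and let $t$ be an integer with $$t\ \ge\ \Big(1+\frac1L\Big)\frac{\sqrt6}{2\pi}\sqrt n\,\log n .$$ Then the number of partitions of $n$ that are not $t$-cores is at most $$C\,p(n)\,\frac{\log n}{n^{1/(2L)}} .$$ -/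

import Mathlib

/-- The Young diagram of a partition `lam` of `n`: the lengths of its rows, from top to bottom, are
the parts of `lam` in weakly decreasing order. The box `(i, j)` is in row `i` and column `j`. -/
def partitionDiagram {n : ℕ} (lam : Nat.Partition n) : YoungDiagram :=
  YoungDiagram.ofRowLens (lam.parts.sort (· ≥ ·))
    (Multiset.pairwise_sort lam.parts (· ≥ ·)).sortedGE

/-- The hook of the box `b`: the boxes of the diagram `mu` that are `b` itself, directly to the
right of `b` (same row) or directly below `b` (same column). -/
def hookCells (mu : YoungDiagram) (b : ℕ × ℕ) : Finset (ℕ × ℕ) :=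
  mu.cells.filter (fun c => (c.1 = b.1 ∧ b.2 ≤ c.2) ∨ (c.2 = b.2 ∧ b.1 ≤ c.1))

/-- The hook length of the box `b`: the number of boxes in its hook. -/
def hookLength (mu : YoungDiagram) (b : ℕ × ℕ) : ℕ := (hookCells mu b).card

/-- A partition is a `t`-core if its Young diagram contains no hook of length `t`. -/
def IsTCore (t : ℕ) {n : ℕ} (lam : Nat.Partition n) : Prop :=
  ∀ b ∈ (partitionDiagram lam).cells, hookLength (partitionDiagram lam) b ≠ t

/-- The number `p(n)` of partitions of `n`. -/
def partitionCount (n : ℕ) : ℕ := Fintype.card (Nat.Partition n)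

/-- The number of partitions of `n` that are not `t`-cores. -/
noncomputable def nonCoreCount (t n : ℕ) : ℕ :=
  {lam : Nat.Partition n | ¬ IsTCore t lam}.ncard

/-! A hook of length `t` can be stripped off as a rim hook, leaving a diagram of size `n - t`; the
rim hook is recovered from that smaller diagram once its bottom row is known. When `(t + 1) ^ 2 >
n`, a hook of length `t` starts in one of the first `t` rows or, after transposing, one of the first
`t` columns, so only `O(t)` bottom rows occur and the non-cores number at most `4 * t * p(n - t)`
(`nonCoreCount_le`).

It remains to show that `p(n - t) / p(n)` is at most a constant times `exp (-π t / √(6 n))`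
(`exists_partitionCount_sub_le`). Since `t * exp (-a * t)` decreases for `a * t ≥ 1`, the worst `t`
is the smallest allowed one, where the exponential equals `n ^ (-1/2) * n ^ (-1 / (2 L))` and the
prefactor `t` contributes `√n * log n`.

The ratio bound follows from the order of magnitude `p(n) ≍ exp (π √(2 n / 3)) / n`, obtained
without the circle method. Euler's recurrence `n p(n) = ∑ σ(k) p(n - k)` has positive coefficients,
so it obeys a comparison principle (`exists_le_mul_of_sigma_recurrence`). The functions `hrFun n *
(1 ∓ (n + 2) ^ (-1/4))` are a supersolution and a subsolution for large `n`. Checking this needs `∑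
k ^ j σ(k) exp (-s k)` for `j = 0, 1, 2` with good error terms as `s → 0`; these come from the
transformation law of the Eisenstein series `G2`, followed by finite differences in `s`. -/

/-! ### Hooks and removal of rim hooks. -/

theorem hookLength_add {mu : YoungDiagram} {i j : ℕ} (h : (i, j) ∈ mu) :
    hookLength mu (i, j) + i + j + 1 = mu.rowLen i + mu.colLen j := by
  have hr := YoungDiagram.mem_iff_lt_rowLen.1 h
  have hc := YoungDiagram.mem_iff_lt_colLen.1 h
  have key : hookCells mu (i, j) =
      ({i} ×ˢ Finset.Ico j (mu.rowLen i)) ∪ (Finset.Ico (i + 1) (mu.colLen j) ×ˢ {j}) := by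
    ext ⟨r, c⟩
    simp only [hookCells, Finset.mem_filter, YoungDiagram.mem_cells, Finset.mem_union,
      Finset.mem_product, Finset.mem_singleton, Finset.mem_Ico]
    constructor
    · rintro ⟨hm, ⟨rfl, h2⟩ | ⟨rfl, h2⟩⟩
      · exact Or.inl ⟨rfl, h2, YoungDiagram.mem_iff_lt_rowLen.1 hm⟩
      · rcases h2.eq_or_lt with h3 | h3
        · subst h3
          exact Or.inl ⟨rfl, le_rfl, hr⟩
        · exact Or.inr ⟨⟨h3, YoungDiagram.mem_iff_lt_colLen.1 hm⟩, rfl⟩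
    · rintro (⟨rfl, h2, h3⟩ | ⟨⟨h2, h3⟩, rfl⟩)
      · exact ⟨YoungDiagram.mem_iff_lt_rowLen.2 h3, Or.inl ⟨rfl, h2⟩⟩
      · exact ⟨YoungDiagram.mem_iff_lt_colLen.2 h3, Or.inr ⟨rfl, by omega⟩⟩
  have hd : Disjoint ({i} ×ˢ Finset.Ico j (mu.rowLen i))
      (Finset.Ico (i + 1) (mu.colLen j) ×ˢ ({j} : Finset ℕ)) := by
    rw [Finset.disjoint_left]
    rintro ⟨r, c⟩ h1 h2
    simp only [Finset.mem_product, Finset.mem_singleton, Finset.mem_Ico] at h1 h2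
    omega
  rw [hookLength, key, Finset.card_union_of_disjoint hd]
  simp only [Finset.card_product, Finset.card_singleton, Nat.card_Ico, one_mul, mul_one]
  omega

/-- The diagram obtained by removing the rim hook corresponding to the hook of the box `(i, j)`. -/
def removeRimHook (mu : YoungDiagram) (i j : ℕ) : YoungDiagram where
  cells := mu.cells.filter fun x => x.1 < i ∨ x.2 < j ∨ (x.1 + 1, x.2 + 1) ∈ mu
  isLowerSet := by
    rintro ⟨r, c⟩ ⟨r', c'⟩ ⟨hr : r' ≤ r, hc : c' ≤ c⟩ h
    simp only [Finset.coe_filter, YoungDiagram.mem_cells, Set.mem_ofPred_eq] at h ⊢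
    refine ⟨mu.up_left_mem hr hc h.1, ?_⟩
    rcases h.2 with h | h | h
    · exact Or.inl (by omega)
    · exact Or.inr (Or.inl (by omega))
    · exact Or.inr (Or.inr (mu.up_left_mem (by omega) (by omega) h))

theorem mem_removeRimHook {mu : YoungDiagram} {i j r c : ℕ} :
    (r, c) ∈ removeRimHook mu i j ↔
      (r, c) ∈ mu ∧ (r < i ∨ c < j ∨ (r + 1, c + 1) ∈ mu) := by
  rw [← YoungDiagram.mem_cells, removeRimHook, Finset.mem_filter, YoungDiagram.mem_cells]

/-- The diagonal shift by `(1, 1)` maps the surviving boxes weakly south-east of `(i, j)` onto the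
boxes strictly south-east of it, so the number of boxes lost is that of the hook itself. -/
theorem card_removeRimHook {mu : YoungDiagram} (i j : ℕ) :
    (removeRimHook mu i j).card + hookLength mu (i, j) = mu.card := by
  set A := mu.cells.filter fun x => x.1 < i ∨ x.2 < j with hA
  set B := mu.cells.filter fun x => ¬ (x.1 < i ∨ x.2 < j) ∧ (x.1 + 1, x.2 + 1) ∈ mu with hB
  set D := mu.cells.filter fun x => i < x.1 ∧ j < x.2 with hD
  have h1 : (removeRimHook mu i j).card = A.card + B.card := by
    rw [← Finset.card_union_of_disjoint]
    · refine congrArg Finset.card ?_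
      ext ⟨r, c⟩
      simp only [removeRimHook, hA, hB, Finset.mem_filter, Finset.mem_union]
      tauto
    · rw [Finset.disjoint_left]
      rintro x h1 h2
      exact (Finset.mem_filter.1 h2).2.1 (Finset.mem_filter.1 h1).2
  have h2 : B.card = D.card := by
    refine Finset.card_bij (fun x _ => (x.1 + 1, x.2 + 1)) ?_ ?_ ?_
    · rintro ⟨r, c⟩ h
      simp only [hB, hD, Finset.mem_filter, YoungDiagram.mem_cells] at h ⊢
      exact ⟨h.2.2, by omega⟩
    · rintro ⟨r, c⟩ _ ⟨r', c'⟩ _ h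
      simpa using h
    · rintro ⟨r, c⟩ h
      simp only [hD, Finset.mem_filter, YoungDiagram.mem_cells] at h
      obtain ⟨r, rfl⟩ : ∃ r', r = r' + 1 := ⟨r - 1, by omega⟩
      obtain ⟨c, rfl⟩ : ∃ c', c = c' + 1 := ⟨c - 1, by omega⟩
      refine ⟨(r, c), ?_, rfl⟩
      simp only [hB, Finset.mem_filter, YoungDiagram.mem_cells]
      exact ⟨mu.up_left_mem (by omega) (by omega) h.1, by omega, h.1⟩
  have h3 : mu.card = A.card + (hookCells mu (i, j)).card + D.card := by
    rw [← Finset.card_union_of_disjoint, ← Finset.card_union_of_disjoint]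
    · refine congrArg Finset.card ?_
      ext ⟨r, c⟩
      simp only [hA, hD, hookCells, Finset.mem_union, Finset.mem_filter, ← and_or_left]
      refine ⟨fun h => ⟨h, by omega⟩, fun h => h.1⟩
    · rw [Finset.disjoint_left]
      rintro ⟨r, c⟩ h1 h2
      simp only [hA, hD, hookCells, Finset.mem_union, Finset.mem_filter] at h1 h2
      omega
    · rw [Finset.disjoint_left]
      rintro ⟨r, c⟩ h1 h2
      simp only [hA, hookCells, Finset.mem_filter] at h1 h2
      omega
  rw [h1, h2, h3, hookLength]
  omega

/-- The rim hook ends at the foot of column `j`. Hence `j` can be read off from the remaining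
diagram and the index of the rim hook's bottom row. -/
theorem rowLen_removeRimHook {mu : YoungDiagram} {i j : ℕ} (h : (i, j) ∈ mu) :
    (removeRimHook mu i j).rowLen (mu.colLen j - 1) = j := by
  have hc := YoungDiagram.mem_iff_lt_colLen.1 h
  have hb : (mu.colLen j - 1, j) ∈ mu := YoungDiagram.mem_iff_lt_colLen.2 (by omega)
  have hb' : (mu.colLen j, j) ∉ mu := fun h => lt_irrefl _ (YoungDiagram.mem_iff_lt_colLen.1 h)
  refine le_antisymm ?_ ?_
  · by_contra! hlt
    have := mem_removeRimHook.1 (YoungDiagram.mem_iff_lt_rowLen.2 hlt)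
    rcases this.2 with h1 | h1 | h1
    · omega
    · omega
    · exact hb' (mu.up_left_mem (by omega) (by omega) h1)
  · by_contra! hlt
    have : (mu.colLen j - 1, (removeRimHook mu i j).rowLen (mu.colLen j - 1)) ∈
        removeRimHook mu i j :=
      mem_removeRimHook.2 ⟨mu.up_left_mem le_rfl hlt.le hb, Or.inr (Or.inl hlt)⟩
    exact lt_irrefl _ (YoungDiagram.mem_iff_lt_rowLen.1 this)

/-- A diagram can be recovered after removing a rim hook from the contents of the rim hook. -/
theorem mem_iff_mem_removeRimHook {mu : YoungDiagram} {i j : ℕ} (h : (i, j) ∈ mu) (r c : ℕ) :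
    (r, c) ∈ mu ↔ (r, c) ∈ removeRimHook mu i j ∨
      (j + r ≤ (mu.colLen j - 1) + c ∧
        (mu.colLen j - 1) + c < j + r + hookLength mu (i, j) ∧
        (r = 0 ∨ c = 0 ∨ (r - 1, c - 1) ∈ removeRimHook mu i j)) := by
  have hr := YoungDiagram.mem_iff_lt_rowLen.1 h
  have hc := YoungDiagram.mem_iff_lt_colLen.1 h
  have hk := hookLength_add h
  constructor
  · intro hm
    by_cases hm' : (r, c) ∈ removeRimHook mu i j
    · exact Or.inl hm'
    right
    rw [mem_removeRimHook] at hm'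
    simp only [hm, true_and, not_or, not_lt] at hm'
    -- A removed box lies weakly south-east of `(i, j)`. The foot of column `j` and the end of row
    -- `i` bound its content `c - r`, and `hookLength_add` turns the second bound into the hook
    -- length.
    have h1 := YoungDiagram.mem_iff_lt_colLen.1 (mu.up_left_mem (le_refl r) hm'.2.1 hm)
    have h2 := YoungDiagram.mem_iff_lt_rowLen.1 (mu.up_left_mem hm'.1 (le_refl c) hm)
    refine ⟨by omega, by omega, ?_⟩
    by_cases hr0 : r = 0
    · exact Or.inl hr0
    by_cases hc0 : c = 0
    · exact Or.inr (Or.inl hc0)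
    right; right
    rw [mem_removeRimHook]
    refine ⟨mu.up_left_mem (by omega) (by omega) hm, Or.inr (Or.inr ?_)⟩
    rwa [Nat.sub_add_cancel (by omega), Nat.sub_add_cancel (by omega)]
  · rintro (hm | ⟨h1, h2, h3⟩)
    · exact (mem_removeRimHook.1 hm).1
    · by_cases hri : r ≤ i
      · exact mu.up_left_mem hri le_rfl (YoungDiagram.mem_iff_lt_rowLen.2 (by omega))
      by_cases hcj : c ≤ j
      · exact mu.up_left_mem le_rfl hcj (YoungDiagram.mem_iff_lt_colLen.2 (by omega))
      rcases h3 with h3 | h3 | h3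
      · omega
      · omega
      · rcases (mem_removeRimHook.1 h3).2 with h4 | h4 | h4
        · omega
        · omega
        · rwa [Nat.sub_add_cancel (by omega), Nat.sub_add_cancel (by omega)] at h4

/-! ### Partitions of `n` as Young diagrams with `n` boxes. -/

theorem card_ofRowLens {w : List ℕ} (hw : w.SortedGE) :
    (YoungDiagram.ofRowLens w hw).card = w.sum := by
  change (YoungDiagram.cellsOfRowLens w).card = w.sum
  clear hw
  induction w with
  | nil => rfl
  | cons a l ih =>
    rw [YoungDiagram.cellsOfRowLens, Finset.card_union_of_disjoint]
    · simp [ih]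
    · rw [Finset.disjoint_left]
      rintro ⟨r, c⟩ h1 h2
      simp at h1 h2
      omega

theorem card_partitionDiagram {n : ℕ} (lam : Nat.Partition n) :
    (partitionDiagram lam).card = n := by
  rw [partitionDiagram, card_ofRowLens, ← Multiset.sum_coe, Multiset.sort_eq, lam.parts_sum]

theorem partitionDiagram_injective {n : ℕ} :
    Function.Injective (partitionDiagram : Nat.Partition n → YoungDiagram) := by
  intro a b h
  have key : ∀ c : Nat.Partition n,
      (partitionDiagram c).rowLens = c.parts.sort (· ≥ ·) := fun c =>
    YoungDiagram.rowLens_ofRowLens_eq_self fun x hx =>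
      c.parts_pos ((Multiset.mem_sort _).1 hx)
  have h2 : a.parts.sort (· ≥ ·) = b.parts.sort (· ≥ ·) := by rw [← key, ← key, h]
  ext1
  rw [← Multiset.sort_eq a.parts (· ≥ ·), h2, Multiset.sort_eq]

theorem range_partitionDiagram (n : ℕ) :
    Set.range (partitionDiagram : Nat.Partition n → YoungDiagram) = {mu | mu.card = n} := by
  ext mu
  constructor
  · rintro ⟨lam, rfl⟩
    exact card_partitionDiagram lam
  · intro h
    have hs : mu.rowLens.sum = n := by
      rw [← card_ofRowLens mu.rowLens_sorted, YoungDiagram.ofRowLens_to_rowLens_eq_self]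
      exact h
    refine ⟨⟨mu.rowLens, fun hx => mu.pos_of_mem_rowLens _ hx, by rw [Multiset.sum_coe, hs]⟩, ?_⟩
    have h3 : (mu.rowLens : Multiset ℕ).sort (· ≥ ·) = mu.rowLens := by
      rw [Multiset.coe_sort]
      exact List.mergeSort_of_pairwise (by simpa using mu.rowLens_sorted.pairwise)
    have h4 : ∀ (w : List ℕ) (hw : w.SortedGE), w = mu.rowLens →
        YoungDiagram.ofRowLens w hw = mu := by
      rintro w hw rfl
      exact YoungDiagram.ofRowLens_to_rowLens_eq_self
    exact h4 _ _ h3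

theorem ncard_youngDiagram (n : ℕ) :
    {mu : YoungDiagram | mu.card = n}.ncard = partitionCount n := by
  rw [← range_partitionDiagram, ← Set.image_univ,
    Set.ncard_image_of_injective _ partitionDiagram_injective, Set.ncard_univ,
    Nat.card_eq_fintype_card, partitionCount]

theorem finite_youngDiagram (n : ℕ) : {mu : YoungDiagram | mu.card = n}.Finite := by
  rw [← range_partitionDiagram]
  exact Set.finite_range _

theorem nonCoreCount_eq (t n : ℕ) :
    nonCoreCount t n =
      {mu : YoungDiagram | mu.card = n ∧ ∃ b ∈ mu, hookLength mu b = t}.ncard := by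
  rw [nonCoreCount, ← Set.ncard_image_of_injective _ partitionDiagram_injective]
  congr 1
  ext mu
  simp only [Set.mem_image, Set.mem_ofPred_eq, IsTCore]
  push Not
  constructor
  · rintro ⟨lam, ⟨b, hb, h⟩, rfl⟩
    exact ⟨card_partitionDiagram lam, b, hb, h⟩
  · rintro ⟨h, b, hb, hk⟩
    obtain ⟨lam, rfl⟩ : mu ∈ Set.range (partitionDiagram : Nat.Partition n → YoungDiagram) := by
      rw [range_partitionDiagram]
      exact h
    exact ⟨lam, ⟨b, hb, hk⟩, rfl⟩

/-! ### Counting the partitions that are not `t`-cores. -/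

theorem hookLength_transpose (mu : YoungDiagram) (b : ℕ × ℕ) :
    hookLength mu.transpose b.swap = hookLength mu b := by
  refine Finset.card_bij (fun x _ => x.swap) ?_ ?_ ?_
  · rintro ⟨r, c⟩ h
    simp only [hookCells, Finset.mem_filter, YoungDiagram.mem_cells,
      YoungDiagram.mem_transpose] at h ⊢
    exact ⟨h.1, h.2.symm⟩
  · rintro x _ y _ h
    exact Prod.swap_injective h
  · rintro ⟨r, c⟩ h
    refine ⟨(c, r), ?_, rfl⟩
    simp only [hookCells, Finset.mem_filter, YoungDiagram.mem_cells,
      YoungDiagram.mem_transpose] at h ⊢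
    exact ⟨h.1, h.2.symm⟩

theorem card_transpose (mu : YoungDiagram) : mu.transpose.card = mu.card := by
  simp [YoungDiagram.card, YoungDiagram.transpose]

theorem ncard_hook_le (t n : ℕ) :
    {mu : YoungDiagram | mu.card = n ∧ ∃ i j, (i, j) ∈ mu ∧ hookLength mu (i, j) = t ∧ i < t}.ncard
      ≤ 2 * t * partitionCount (n - t) := by
  set S := {mu : YoungDiagram | mu.card = n ∧
    ∃ i j, (i, j) ∈ mu ∧ hookLength mu (i, j) = t ∧ i < t} with hS
  have hex : ∀ mu ∈ S, ∃ i j, (i, j) ∈ mu ∧ hookLength mu (i, j) = t ∧ i < t := fun mu h => h.2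
  choose! i j hmem hlen hlt using hex
  have hcard : (Set.Iio (2 * t) ×ˢ {mu : YoungDiagram | mu.card = n - t}).ncard =
      2 * t * partitionCount (n - t) := by
    rw [Set.ncard_prod, ncard_youngDiagram, ← Finset.coe_Iio, Set.ncard_coe_finset, Nat.card_Iio]
  rw [← hcard]
  -- The row index is below `2 * t` because `hookLength_add` and `rowLen i ≥ j + 1` give `colLen j ≤
  -- t + i`. Injectivity is the reconstruction `mem_iff_mem_removeRimHook`.
  refine Set.ncard_le_ncard_of_injOn
    (fun mu => (mu.colLen (j mu) - 1, removeRimHook mu (i mu) (j mu))) ?_ ?_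
    ((Set.finite_Iio _).prod (finite_youngDiagram _))
  · intro mu hmu
    have h1 := hookLength_add (hmem mu hmu)
    have h2 := YoungDiagram.mem_iff_lt_rowLen.1 (hmem mu hmu)
    have h3 := card_removeRimHook (mu := mu) (i mu) (j mu)
    have h4 := hlen mu hmu
    have h5 := hlt mu hmu
    have h6 : mu.card = n := hmu.1
    exact ⟨Set.mem_Iio.2 (by dsimp only; omega), by
      change (removeRimHook mu (i mu) (j mu)).card = n - t; omega⟩
  · intro mu hmu nu hnu h
    simp only [Prod.mk.injEq] at h
    have hj : j mu = j nu := by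
      rw [← rowLen_removeRimHook (hmem mu hmu), ← rowLen_removeRimHook (hmem nu hnu), h.1, h.2]
    ext ⟨r, c⟩
    rw [YoungDiagram.mem_cells, YoungDiagram.mem_cells,
      mem_iff_mem_removeRimHook (hmem mu hmu), mem_iff_mem_removeRimHook (hmem nu hnu),
      hlen mu hmu, hlen nu hnu, h.1, h.2, hj]

theorem nonCoreCount_le {t n : ℕ} (h : n < (t + 1) ^ 2) :
    nonCoreCount t n ≤ 4 * t * partitionCount (n - t) := by
  set S := {mu : YoungDiagram | mu.card = n ∧
    ∃ i j, (i, j) ∈ mu ∧ hookLength mu (i, j) = t ∧ i < t} with hS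
  have hfin : S.Finite := (finite_youngDiagram n).subset fun mu h => h.1
  have hsub : {mu : YoungDiagram | mu.card = n ∧ ∃ b ∈ mu, hookLength mu b = t} ⊆
      S ∪ YoungDiagram.transpose '' S := by
    rintro mu ⟨hn, ⟨i, j⟩, hm, hk⟩
    by_cases hi : i < t
    · exact Or.inl ⟨hn, i, j, hm, hk, hi⟩
    by_cases hj : j < t
    · refine Or.inr ⟨mu.transpose, ⟨by rw [card_transpose, hn], j, i, ?_, ?_, hj⟩,
        mu.transpose_transpose⟩
      · simpa using hm
      · rw [← hk, ← hookLength_transpose mu (i, j)]; rfl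
    exfalso
    -- A corner with both coordinates at least `t` would force a square of `(t + 1) ^ 2 > n` boxes.
    have : Finset.range (t + 1) ×ˢ Finset.range (t + 1) ⊆ mu.cells := by
      rintro ⟨r, c⟩ hx
      simp only [Finset.mem_product, Finset.mem_range] at hx
      exact mu.up_left_mem (by omega) (by omega) hm
    have := Finset.card_le_card this
    rw [Finset.card_product, Finset.card_range] at this
    have hn' : mu.cells.card = n := hn
    nlinarith
  have h1 := ncard_hook_le t n
  rw [nonCoreCount_eq]
  calc _ ≤ (S ∪ YoungDiagram.transpose '' S).ncard :=
        Set.ncard_le_ncard hsub (hfin.union (hfin.image _))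
    _ ≤ S.ncard + (YoungDiagram.transpose '' S).ncard := Set.ncard_union_le _ _
    _ ≤ S.ncard + S.ncard := Nat.add_le_add_left (Set.ncard_image_le hfin) _
    _ ≤ _ := by rw [← hS] at h1; linarith

theorem nonCoreCount_eq_zero {t n : ℕ} (h : n < t) : nonCoreCount t n = 0 := by
  rw [nonCoreCount_eq]
  convert Set.ncard_empty YoungDiagram
  ext mu
  simp only [Set.mem_ofPred_eq, Set.mem_empty_iff_false, iff_false]
  rintro ⟨hn, b, -, hk⟩
  have h1 : hookLength mu b ≤ mu.card := Finset.card_filter_le _ _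
  omega

theorem nonCoreCount_le_partitionCount (t n : ℕ) : nonCoreCount t n ≤ partitionCount n := by
  rw [nonCoreCount_eq, ← ncard_youngDiagram]
  exact Set.ncard_le_ncard (fun mu h => h.1) (finite_youngDiagram n)

/-! ### Euler's recurrence. -/

/-- Adjoining `j` copies of the part `v` is a bijection from the partitions of `n - j * v`. -/
theorem card_partition_le_count {n v j : ℕ} (hv : 1 ≤ v) (h : j * v ≤ n) :
    (Finset.univ.filter fun lam : Nat.Partition n => j ≤ lam.parts.count v).card =
      partitionCount (n - j * v) := by
  rw [partitionCount, ← Finset.card_univ]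
  symm
  refine Finset.card_bij
    (fun mu _ => (⟨Multiset.replicate j v + mu.parts, fun {i} hi => ?_, ?_⟩ : Nat.Partition n))
    ?_ ?_ ?_
  · rcases Multiset.mem_add.1 hi with hi | hi
    · rw [Multiset.eq_of_mem_replicate hi]
      exact hv
    · exact mu.parts_pos hi
  · rw [Multiset.sum_add, Multiset.sum_replicate, mu.parts_sum, smul_eq_mul]
    omega
  · intro mu _
    simp
  · intro mu _ nu _ hmn
    ext1
    simpa using hmn
  · intro lam hlam
    have hle : Multiset.replicate j v ≤ lam.parts :=
      Multiset.le_count_iff_replicate_le.1 (Finset.mem_filter.1 hlam).2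
    refine ⟨⟨lam.parts - Multiset.replicate j v, fun {i} hi =>
      lam.parts_pos (Multiset.mem_of_le (Multiset.sub_le_self _ _) hi), ?_⟩, Finset.mem_univ _, ?_⟩
    · have := congrArg Multiset.sum (add_tsub_cancel_of_le hle)
      rw [Multiset.sum_add, Multiset.sum_replicate, lam.parts_sum, smul_eq_mul] at this
      omega
    · ext1
      exact add_tsub_cancel_of_le hle

theorem multiset_sum_le_sum_of_le {s t : Multiset ℕ} (h : s ≤ t) : s.sum ≤ t.sum := by
  obtain ⟨u, rfl⟩ := Multiset.le_iff_exists_add.1 h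
  simp

theorem partition_eq_sum_count {n : ℕ} (lam : Nat.Partition n) :
    n = ∑ v ∈ Finset.Icc 1 n, ∑ j ∈ Finset.Icc 1 n, if j ≤ lam.parts.count v then v else 0 := by
  have h1 : ∀ v ∈ Finset.Icc 1 n,
      (∑ j ∈ Finset.Icc 1 n, if j ≤ lam.parts.count v then v else 0) =
        lam.parts.count v * v := by
    intro v hv
    have hle : lam.parts.count v ≤ n := by
      have h2 : (Multiset.replicate (lam.parts.count v) v).sum ≤ lam.parts.sum :=
        multiset_sum_le_sum_of_le (Multiset.le_count_iff_replicate_le.1 le_rfl)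
      rw [Multiset.sum_replicate, smul_eq_mul, lam.parts_sum] at h2
      have := (Finset.mem_Icc.1 hv).1
      nlinarith
    have h3 : (Finset.Icc 1 n).filter (fun j => j ≤ lam.parts.count v) =
        Finset.Icc 1 (lam.parts.count v) := by
      ext j
      simp only [Finset.mem_filter, Finset.mem_Icc]
      omega
    rw [← Finset.sum_filter, h3]
    simp
  rw [Finset.sum_congr rfl h1]
  conv_lhs => rw [← lam.parts_sum, Finset.sum_multiset_count]
  simp only [smul_eq_mul]
  refine Finset.sum_subset ?_ ?_
  · intro v hv
    rw [Multiset.mem_toFinset] at hv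
    exact Finset.mem_Icc.2 ⟨lam.parts_pos hv, Nat.Partition.le_of_mem_parts hv⟩
  · intro v _ hv
    rw [Multiset.mem_toFinset] at hv
    rw [Multiset.count_eq_zero_of_notMem hv, zero_mul]

/-- Euler's recurrence `n p(n) = ∑ σ(k) p(n - k)`. -/
theorem mul_partitionCount (n : ℕ) :
    n * partitionCount n =
      ∑ k ∈ Finset.Icc 1 n, ArithmeticFunction.sigma 1 k * partitionCount (n - k) := by
  have h1 : n * partitionCount n = ∑ lam : Nat.Partition n,
      ∑ v ∈ Finset.Icc 1 n, ∑ j ∈ Finset.Icc 1 n, if j ≤ lam.parts.count v then v else 0 := by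
    rw [Finset.sum_congr rfl fun lam _ => (partition_eq_sum_count lam).symm, Finset.sum_const,
      Finset.card_univ, smul_eq_mul, partitionCount, mul_comm]
  have h2 : ∀ v ∈ Finset.Icc 1 n, ∀ j ∈ Finset.Icc 1 n,
      (∑ lam : Nat.Partition n, if j ≤ lam.parts.count v then v else 0) =
        if j * v ≤ n then v * partitionCount (n - j * v) else 0 := by
    intro v hv j _
    rw [← Finset.sum_filter, Finset.sum_const, smul_eq_mul]
    split_ifs with h
    · rw [card_partition_le_count (Finset.mem_Icc.1 hv).1 h, mul_comm]
    · rw [Finset.card_eq_zero.2, zero_mul]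
      refine Finset.filter_eq_empty_iff.2 fun lam _ hc => h ?_
      have h3 : (Multiset.replicate j v).sum ≤ lam.parts.sum :=
        multiset_sum_le_sum_of_le (Multiset.le_count_iff_replicate_le.1 hc)
      rwa [Multiset.sum_replicate, smul_eq_mul, lam.parts_sum] at h3
  have h3 : ∀ k ∈ Finset.Icc 1 n, ArithmeticFunction.sigma 1 k * partitionCount (n - k) =
      ∑ x ∈ k.divisorsAntidiagonal, x.1 * partitionCount (n - x.2 * x.1) := by
    intro k _
    rw [ArithmeticFunction.sigma_one_apply, Finset.sum_mul,
      Nat.sum_divisorsAntidiagonal (fun a b => a * partitionCount (n - b * a))]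
    refine Finset.sum_congr rfl fun d hd => ?_
    rw [Nat.div_mul_cancel (Nat.dvd_of_mem_divisors hd)]
  rw [h1, Finset.sum_comm, Finset.sum_congr rfl h3]
  have h4 : ∀ v ∈ Finset.Icc 1 n, (∑ lam : Nat.Partition n, ∑ j ∈ Finset.Icc 1 n,
      if j ≤ lam.parts.count v then v else 0) =
      ∑ j ∈ Finset.Icc 1 n, if j * v ≤ n then v * partitionCount (n - j * v) else 0 := by
    intro v hv
    rw [Finset.sum_comm]
    exact Finset.sum_congr rfl (h2 v hv)
  rw [Finset.sum_congr rfl h4, ← Finset.sum_product', ← Finset.sum_filter, Finset.sum_sigma']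
  -- Pairs `(v, j)` are grouped by their product `k`; the weights `v` then add up to `σ(k)`.
  refine Finset.sum_bij' (fun x _ => ⟨x.2 * x.1, x⟩) (fun y _ => y.2) ?_ ?_ ?_ ?_ ?_
  · rintro ⟨v, j⟩ h
    simp only [Finset.mem_filter, Finset.mem_product, Finset.mem_Icc] at h
    simp only [Finset.mem_sigma, Finset.mem_Icc, Nat.mem_divisorsAntidiagonal]
    have : 1 ≤ j * v := Nat.mul_pos h.1.2.1 h.1.1.1
    exact ⟨⟨this, h.2⟩, mul_comm _ _, by omega⟩
  · rintro ⟨k, v, j⟩ h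
    simp only [Finset.mem_sigma, Finset.mem_Icc, Nat.mem_divisorsAntidiagonal] at h
    simp only [Finset.mem_filter, Finset.mem_product, Finset.mem_Icc]
    obtain ⟨⟨hk1, hk⟩, rfl, h0⟩ := h
    have hv : 0 < v := Nat.pos_of_ne_zero fun h => by simp [h] at h0
    have hj : 0 < j := Nat.pos_of_ne_zero fun h => by simp [h] at h0
    refine ⟨⟨⟨hv, ?_⟩, hj, ?_⟩, by rwa [mul_comm]⟩ <;> nlinarith
  · rintro ⟨v, j⟩ _
    rfl
  · rintro ⟨k, v, j⟩ h
    simp only [Finset.mem_sigma, Finset.mem_Icc, Nat.mem_divisorsAntidiagonal] at h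
    obtain ⟨_, rfl, _⟩ := h
    simp [mul_comm]
  · rintro ⟨v, j⟩ _
    rfl

theorem partitionCount_pos (n : ℕ) : 0 < partitionCount n :=
  Fintype.card_pos_iff.2 ⟨Nat.Partition.indiscrete n⟩

/-! ### Asymptotics of the divisor sums as `s → 0`. -/

/-- `∑ k ^ j σ(k) exp (-s k)`. -/
noncomputable def sigmaMoment (j : ℕ) (s : ℝ) : ℝ :=
  ∑' k : ℕ, (k : ℝ) ^ j * (ArithmeticFunction.sigma 1 k : ℝ) * Real.exp (-s * k)

theorem sigma_one_le_sq (k : ℕ) : (ArithmeticFunction.sigma 1 k : ℝ) ≤ (k : ℝ) ^ 2 := by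
  exact_mod_cast ArithmeticFunction.sigma_le_pow_succ 1 k

theorem summable_sigmaMoment (j : ℕ) {s : ℝ} (hs : 0 < s) :
    Summable fun k : ℕ =>
      (k : ℝ) ^ j * (ArithmeticFunction.sigma 1 k : ℝ) * Real.exp (-s * k) := by
  refine Summable.of_nonneg_of_le (fun k => by positivity) (fun k => ?_)
    (Real.summable_pow_mul_exp_neg_nat_mul (j + 2) hs)
  rw [pow_add]
  gcongr
  exact sigma_one_le_sq k

theorem sigmaMoment_nonneg (j : ℕ) (s : ℝ) : 0 ≤ sigmaMoment j s :=
  tsum_nonneg fun k => by positivity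

theorem sigmaMoment_zero_eq_tsum_pnat {s : ℝ} (hs : 0 < s) (z : UpperHalfPlane)
    (hz : (z : ℂ) = (s / (2 * Real.pi) : ℝ) * Complex.I) :
    ∑' n : ℕ+, (ArithmeticFunction.sigma 1 (n : ℕ) : ℂ) *
      Complex.exp (2 * Real.pi * Complex.I * z) ^ (n : ℕ) = (sigmaMoment 0 s : ℂ) := by
  have hexp : Complex.exp (2 * Real.pi * Complex.I * z) = (Real.exp (-s) : ℂ) := by
    rw [hz, Complex.ofReal_exp]
    congr 1
    have : (Real.pi : ℂ) ≠ 0 := by exact_mod_cast Real.pi_ne_zero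
    push_cast
    field_simp
    rw [Complex.I_sq]
    ring
  rw [hexp, sigmaMoment, (summable_sigmaMoment 0 hs).tsum_eq_zero_add]
  simp only [ArithmeticFunction.map_zero, Nat.cast_zero, mul_zero, zero_mul, zero_add]
  rw [Complex.ofReal_tsum]
  rw [tsum_pnat_eq_tsum_succ (f := fun n : ℕ =>
    (ArithmeticFunction.sigma 1 n : ℂ) * (Real.exp (-s) : ℂ) ^ n)]
  have h0 : ∀ n : ℕ, (((n : ℝ) ^ 0 * (ArithmeticFunction.sigma 1 n : ℝ) *
      Real.exp (-s * n) : ℝ) : ℂ) =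
      (ArithmeticFunction.sigma 1 n : ℂ) * (Real.exp (-s) : ℂ) ^ n := by
    intro n
    rw [show -s * (n : ℝ) = n * (-s) by ring, Real.exp_nat_mul]
    push_cast
    ring
  exact tsum_congr fun n => (h0 (n + 1)).symm

/-- This is the quasimodularity of `G2` under `z ↦ -1 / z` at `z = i s / (2 π)`, whose image
corresponds to the parameter `4 π ^ 2 / s`. The non-modular correction of `G2` produces the term `1
/ (2 s)`. -/
theorem sigmaMoment_zero_transform {s : ℝ} (hs : 0 < s) :
    sigmaMoment 0 s = Real.pi ^ 2 / (6 * s ^ 2) - 1 / (2 * s) + 1 / 24 -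
      4 * Real.pi ^ 2 / s ^ 2 * sigmaMoment 0 (4 * Real.pi ^ 2 / s) := by
  have hpi := Real.pi_pos
  set z : UpperHalfPlane := ⟨(s / (2 * Real.pi) : ℝ) * Complex.I, by
    simp only [Complex.mul_im, Complex.ofReal_re, Complex.I_im, mul_one, Complex.ofReal_im,
      Complex.I_re, mul_zero, add_zero]
    positivity⟩ with hz
  have hz1 : (z : ℂ) = (s / (2 * Real.pi) : ℝ) * Complex.I := rfl
  have hpi' : (Real.pi : ℂ) ≠ 0 := by exact_mod_cast hpi.ne'
  have hs' : (s : ℂ) ≠ 0 := by exact_mod_cast hs.ne'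
  have hz2 : ((ModularGroup.S • z : UpperHalfPlane) : ℂ) =
      ((4 * Real.pi ^ 2 / s) / (2 * Real.pi) : ℝ) * Complex.I := by
    rw [UpperHalfPlane.modular_S_smul]
    change (-(z : ℂ))⁻¹ = _
    rw [hz1]
    push_cast
    refine inv_eq_of_mul_eq_one_right ?_
    field_simp
    rw [Complex.I_sq]
    ring
  have h := EisensteinSeries.G2_S_transform z
  rw [EisensteinSeries.G2_eq_tsum_cexp, EisensteinSeries.G2_eq_tsum_cexp,
    sigmaMoment_zero_eq_tsum_pnat hs z hz1,
    sigmaMoment_zero_eq_tsum_pnat (by positivity) _ hz2, riemannZeta_two,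
    hz1] at h
  have h2 : ((2 * (Real.pi ^ 2 / 6) - 8 * Real.pi ^ 2 * sigmaMoment 0 s : ℝ) : ℂ) =
      ((-(4 * Real.pi ^ 2 / s ^ 2) * (2 * (Real.pi ^ 2 / 6) -
        8 * Real.pi ^ 2 * sigmaMoment 0 (4 * Real.pi ^ 2 / s)) + 4 * Real.pi ^ 2 / s : ℝ) : ℂ) := by
    push_cast at h ⊢
    rw [h]
    have hI := Complex.I_ne_zero
    field_simp
    rw [Complex.I_sq]
    ring
  have h3 := Complex.ofReal_injective h2
  have h4 : sigmaMoment 0 s = (2 * (Real.pi ^ 2 / 6) - (-(4 * Real.pi ^ 2 / s ^ 2) *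
      (2 * (Real.pi ^ 2 / 6) - 8 * Real.pi ^ 2 * sigmaMoment 0 (4 * Real.pi ^ 2 / s)) +
        4 * Real.pi ^ 2 / s)) / (8 * Real.pi ^ 2) := by
    rw [← h3]
    field_simp
    ring
  rw [h4]
  field_simp
  ring

theorem sq_mul_exp_neg_le (x : ℝ) (hx : 0 ≤ x) : x ^ 2 * Real.exp (-x) ≤ 8 * Real.exp (-x / 2) := by
  have h1 := Real.quadratic_le_exp_of_nonneg (x := x / 2) (by positivity)
  have h2 : Real.exp (-x / 2) = Real.exp (x / 2) * Real.exp (-x) := by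
    rw [← Real.exp_add]; ring_nf
  rw [h2]
  have := Real.exp_pos (-x)
  nlinarith

/-- `∑ σ(k) exp (-s k) = π ^ 2 / (6 s ^ 2) - 1 / (2 s) + O(1)`. -/
theorem exists_abs_sigmaMoment_zero_sub_le : ∃ K : ℝ, 0 < K ∧ ∀ s : ℝ, 0 < s → s ≤ 1 →
    |sigmaMoment 0 s - (Real.pi ^ 2 / (6 * s ^ 2) - 1 / (2 * s))| ≤ K := by
  have hsum : Summable fun k : ℕ => 8 * Real.exp (-(1 / 2 : ℝ) * k) := by
    have := Real.summable_pow_mul_exp_neg_nat_mul 0 (show (0 : ℝ) < 1 / 2 by norm_num)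
    simpa using this.mul_left 8
  refine ⟨1 + ∑' k : ℕ, 8 * Real.exp (-(1 / 2 : ℝ) * k), ?_, fun s hs hs1 => ?_⟩
  · have : 0 ≤ ∑' k : ℕ, 8 * Real.exp (-(1 / 2 : ℝ) * k) := tsum_nonneg fun k => by positivity
    linarith
  set w := 4 * Real.pi ^ 2 / s with hw
  have hpi := Real.pi_gt_three
  have hw1 : 1 ≤ w := by
    rw [hw, le_div_iff₀ hs]
    nlinarith
  -- The dual sum is exponentially small in `w`: its prefactor is at most `w ^ 2`, and `(w k) ^ 2 *
  -- exp (-w k)` is dominated uniformly by a fixed convergent series because `w ≥ 1`.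
  have h1 : 4 * Real.pi ^ 2 / s ^ 2 * sigmaMoment 0 w ≤
      ∑' k : ℕ, 8 * Real.exp (-(1 / 2 : ℝ) * k) := by
    rw [sigmaMoment, ← tsum_mul_left]
    refine Summable.tsum_le_tsum (fun k => ?_)
      ((summable_sigmaMoment 0 (by linarith)).mul_left _) hsum
    have h2 : 4 * Real.pi ^ 2 / s ^ 2 ≤ w ^ 2 := by
      rw [hw, div_pow]
      have : 1 ≤ 4 * Real.pi ^ 2 := by nlinarith
      gcongr
      exact le_self_pow₀ this two_ne_zero
    have h3 := sq_mul_exp_neg_le (w * k) (by positivity)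
    have h4 : Real.exp (-(w * k) / 2) ≤ Real.exp (-(1 / 2 : ℝ) * k) := by
      gcongr
      have : (k : ℝ) ≤ w * k := le_mul_of_one_le_left (by positivity) hw1
      linarith
    calc _ ≤ w ^ 2 * ((k : ℝ) ^ 0 * (k : ℝ) ^ 2 * Real.exp (-w * k)) := by
          gcongr
          exact sigma_one_le_sq k
      _ = (w * k) ^ 2 * Real.exp (-(w * k)) := by ring_nf
      _ ≤ _ := by linarith
  have h0 : 0 ≤ 4 * Real.pi ^ 2 / s ^ 2 * sigmaMoment 0 w :=
    mul_nonneg (by positivity) (sigmaMoment_nonneg _ _)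
  rw [sigmaMoment_zero_transform hs, abs_le]
  constructor <;> linarith

theorem hasSum_sigmaMoment (j : ℕ) {s : ℝ} (hs : 0 < s) :
    HasSum (fun k : ℕ => (k : ℝ) ^ j * (ArithmeticFunction.sigma 1 k : ℝ) * Real.exp (-s * k))
      (sigmaMoment j s) :=
  (summable_sigmaMoment j hs).hasSum

/-- Half of the exponential absorbs `k ^ j`, at the cost of `s ^ (-j)`; the other half leaves the
zeroth moment at `s / 2`. -/
theorem exists_sigmaMoment_le (j : ℕ) : ∃ K : ℝ, 0 < K ∧ ∀ s : ℝ, 0 < s → s ≤ 1 →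
    sigmaMoment j s ≤ K / s ^ (j + 2) := by
  obtain ⟨K, hK, h0⟩ := exists_abs_sigmaMoment_zero_sub_le
  refine ⟨2 ^ j * j.factorial * (4 * Real.pi ^ 2 / 6 + K), by positivity, fun s hs hs1 => ?_⟩
  have h1 : sigmaMoment 0 (s / 2) ≤ (4 * Real.pi ^ 2 / 6 + K) / s ^ 2 := by
    have h2 := (abs_le.1 (h0 (s / 2) (by positivity) (by linarith))).2
    have h3 : 0 < 1 / (2 * (s / 2)) := by positivity
    have h4 : K ≤ K / s ^ 2 := by
      rw [le_div_iff₀ (by positivity)]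
      exact mul_le_of_le_one_right hK.le (pow_le_one₀ hs.le hs1)
    have h5 : Real.pi ^ 2 / (6 * (s / 2) ^ 2) = 4 * Real.pi ^ 2 / 6 / s ^ 2 := by
      field_simp
      ring
    rw [add_div]
    linarith
  have h2 : sigmaMoment j s ≤ 2 ^ j * j.factorial / s ^ j * sigmaMoment 0 (s / 2) := by
    refine hasSum_le (fun k => ?_) (hasSum_sigmaMoment j hs)
      ((hasSum_sigmaMoment 0 (half_pos hs)).mul_left _)
    have h3 := Real.pow_div_factorial_le_exp (x := s / 2 * k) (by positivity) j
    rw [div_le_iff₀ (by positivity), mul_pow, div_pow] at h3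
    have h4 : Real.exp (-s * k) = Real.exp (-(s / 2) * k) * Real.exp (-(s / 2 * k)) := by
      rw [← Real.exp_add]
      ring_nf
    have h5 : (k : ℝ) ^ j * Real.exp (-(s / 2 * k)) ≤ 2 ^ j * j.factorial / s ^ j := by
      rw [Real.exp_neg, ← div_eq_mul_inv, div_le_div_iff₀ (Real.exp_pos _) (by positivity)]
      have : s ^ j / 2 ^ j * (k : ℝ) ^ j = (k : ℝ) ^ j * s ^ j / 2 ^ j := by ring
      rw [this, div_le_iff₀ (by positivity)] at h3
      linarith
    rw [h4]
    calc _ = ((k : ℝ) ^ j * Real.exp (-(s / 2 * k))) *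
          ((ArithmeticFunction.sigma 1 k : ℝ) * Real.exp (-(s / 2) * k)) := by ring
      _ ≤ 2 ^ j * j.factorial / s ^ j *
          ((ArithmeticFunction.sigma 1 k : ℝ) * Real.exp (-(s / 2) * k)) := by gcongr
      _ = _ := by ring
  calc _ ≤ _ := h2
    _ ≤ 2 ^ j * j.factorial / s ^ j * ((4 * Real.pi ^ 2 / 6 + K) / s ^ 2) := by gcongr
    _ = _ := by rw [pow_add]; field_simp

/-- Termwise `1 - exp (-x) ≤ x ≤ exp x - 1` with `x = h * k`: one-sided differences of the zeroth
moment enclose the first moment, so no series has to be differentiated. -/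
theorem sigmaMoment_one_bounds {s h : ℝ} (hh : 0 < h) (hs : h < s) :
    sigmaMoment 0 s - sigmaMoment 0 (s + h) ≤ h * sigmaMoment 1 s ∧
      h * sigmaMoment 1 s ≤ sigmaMoment 0 (s - h) - sigmaMoment 0 s := by
  have hs0 : 0 < s := hh.trans hs
  have e1 := hasSum_sigmaMoment 0 hs0
  have e2 := hasSum_sigmaMoment 0 (add_pos hs0 hh)
  have e3 := hasSum_sigmaMoment 0 (sub_pos.2 hs)
  have e4 := (hasSum_sigmaMoment 1 hs0).mul_left h
  constructor
  · refine hasSum_le (fun k => ?_) (e1.sub e2) e4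
    have h1 : Real.exp (-(s + h) * k) = Real.exp (-s * k) * Real.exp (-(h * k)) := by
      rw [← Real.exp_add]
      ring_nf
    have h2 := Real.add_one_le_exp (-(h * k))
    have h3 : 0 ≤ (ArithmeticFunction.sigma 1 k : ℝ) * Real.exp (-s * k) := by positivity
    rw [h1]
    nlinarith
  · refine hasSum_le (fun k => ?_) e4 (e3.sub e1)
    have h1 : Real.exp (-(s - h) * k) = Real.exp (-s * k) * Real.exp (h * k) := by
      rw [← Real.exp_add]
      ring_nf
    have h2 := Real.add_one_le_exp (h * k)
    have h3 : 0 ≤ (ArithmeticFunction.sigma 1 k : ℝ) * Real.exp (-s * k) := by positivity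
    rw [h1]
    nlinarith

theorem sq_le_exp_add_exp_neg_sub_two (x : ℝ) (hx : 0 ≤ x) :
    x ^ 2 ≤ Real.exp x + Real.exp (-x) - 2 := by
  have h1 : x / 2 ≤ Real.sinh (x / 2) := Real.self_le_sinh_iff.2 (by positivity)
  have h2 := Real.cosh_sq (x / 2)
  have h3 := Real.cosh_two_mul (x / 2)
  rw [mul_div_cancel₀ _ (two_ne_zero' ℝ)] at h3
  have h4 := Real.cosh_eq x
  nlinarith

theorem exp_add_exp_neg_sub_two_le (x : ℝ) (hx : 0 ≤ x) :
    Real.exp x + Real.exp (-x) - 2 ≤ x ^ 2 + x ^ 4 * Real.exp x := by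
  have h0 : 1 ≤ Real.exp x := Real.one_le_exp hx
  rcases le_total x 1 with h | h
  · have h1 := Real.cosh_le_exp_half_sq x
    rw [Real.cosh_eq] at h1
    have hx2 : x ^ 2 ≤ 1 := pow_le_one₀ hx h
    have h2 := (abs_le.1 (Real.abs_exp_sub_one_sub_id_le (x := x ^ 2 / 2) (by
      rw [abs_of_nonneg (by positivity)]; linarith))).2
    have h3 : 0 ≤ x ^ 4 := by positivity
    nlinarith
  · have h1 : Real.exp (-x) ≤ 1 := Real.exp_le_one_iff.2 (by linarith)
    have h2 : 1 ≤ x ^ 4 := one_le_pow₀ h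
    nlinarith

/-- The second-difference analogue, from `x ^ 2 ≤ exp x + exp (-x) - 2 ≤ x ^ 2 + x ^ 4 * exp x` with
`x = h * k`. -/
theorem sigmaMoment_two_bounds {s h : ℝ} (hh : 0 < h) (hs : h < s) :
    h ^ 2 * sigmaMoment 2 s ≤
      sigmaMoment 0 (s - h) + sigmaMoment 0 (s + h) - 2 * sigmaMoment 0 s ∧
    sigmaMoment 0 (s - h) + sigmaMoment 0 (s + h) - 2 * sigmaMoment 0 s ≤
      h ^ 2 * sigmaMoment 2 s + h ^ 4 * sigmaMoment 4 (s - h) := by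
  have hs0 : 0 < s := hh.trans hs
  have e1 := (hasSum_sigmaMoment 0 hs0).mul_left 2
  have e2 := hasSum_sigmaMoment 0 (add_pos hs0 hh)
  have e3 := hasSum_sigmaMoment 0 (sub_pos.2 hs)
  have e4 := (hasSum_sigmaMoment 2 hs0).mul_left (h ^ 2)
  have e5 := (hasSum_sigmaMoment 4 (sub_pos.2 hs)).mul_left (h ^ 4)
  have h1 : ∀ k : ℕ, Real.exp (-(s + h) * k) = Real.exp (-s * k) * Real.exp (-(h * k)) := by
    intro k
    rw [← Real.exp_add]
    ring_nf
  have h2 : ∀ k : ℕ, Real.exp (-(s - h) * k) = Real.exp (-s * k) * Real.exp (h * k) := by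
    intro k
    rw [← Real.exp_add]
    ring_nf
  constructor
  · refine hasSum_le (fun k => ?_) e4 ((e3.add e2).sub e1)
    have h3 := mul_le_mul_of_nonneg_left (sq_le_exp_add_exp_neg_sub_two (h * k) (by positivity))
      (show 0 ≤ (ArithmeticFunction.sigma 1 k : ℝ) * Real.exp (-s * k) by positivity)
    rw [h1, h2]
    linarith
  · refine hasSum_le (fun k => ?_) ((e3.add e2).sub e1) (e4.add e5)
    have h3 := mul_le_mul_of_nonneg_left (exp_add_exp_neg_sub_two_le (h * k) (by positivity))
      (show 0 ≤ (ArithmeticFunction.sigma 1 k : ℝ) * Real.exp (-s * k) by positivity)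
    rw [h1, h2]
    linarith

theorem one_div_one_add_sq_le {x : ℝ} (h0 : 0 ≤ x) :
    1 / (1 + x) ^ 2 ≤ 1 - 2 * x + 3 * x ^ 2 := by
  rw [div_le_iff₀ (by positivity)]
  have : 0 ≤ x ^ 3 * (4 + 3 * x) := by positivity
  linarith

theorem one_div_one_sub_sq_le {x : ℝ} (h1 : x ≤ 1 / 4) :
    1 / (1 - x) ^ 2 ≤ 1 + 2 * x + 8 * x ^ 2 := by
  have h2 : 0 < 1 - x := by linarith
  rw [div_le_iff₀ (by positivity)]
  have : 0 ≤ x ^ 2 * (5 - 14 * x + 8 * x ^ 2) := mul_nonneg (by positivity) (by nlinarith)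
  linarith

theorem le_two_mul_one_add_div {x : ℝ} (h1 : x ≤ 1 / 8) :
    2 + 6 * x ≤ 2 * (1 + x) / (1 - x) ^ 2 := by
  have h2 : 0 < 1 - x := by linarith
  rw [le_div_iff₀ (by positivity)]
  have : 0 ≤ x ^ 2 * (10 - 6 * x) := mul_nonneg (by positivity) (by linarith)
  linarith

theorem two_mul_one_add_div_le {x : ℝ} (h1 : x ≤ 1 / 8) :
    2 * (1 + x) / (1 - x) ^ 2 ≤ 2 + 6 * x + 24 * x ^ 2 := by
  have h2 : 0 < 1 - x := by linarith
  rw [div_le_iff₀ (by positivity)]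
  have : 0 ≤ x ^ 2 * (14 - 42 * x + 24 * x ^ 2) := mul_nonneg (by positivity) (by nlinarith)
  linarith

/-- `∑ k σ(k) exp (-s k) = π ^ 2 / (3 s ^ 3) + O(s ^ (-2))`. -/
theorem exists_abs_sigmaMoment_one_sub_le : ∃ K : ℝ, 0 < K ∧ ∀ s : ℝ, 0 < s → s ≤ 1 / 2 →
    |sigmaMoment 1 s - Real.pi ^ 2 / (3 * s ^ 3)| ≤ K / s ^ 2 := by
  obtain ⟨K, hK, h0⟩ := exists_abs_sigmaMoment_zero_sub_le
  set P := Real.pi ^ 2 / 6 with hP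
  have hP0 : 0 < P := by positivity
  refine ⟨4 * P + 1 / 2 + 4 * K, by positivity, fun s hs hs1 => ?_⟩
  -- The step `h = s ^ 2 / 2` balances two errors of order `s ^ (-2)`: the `O(1)` remainder divided
  -- by `h`, and the discretisation error `h / s ^ 4`.
  obtain ⟨b1, b2⟩ := sigmaMoment_one_bounds (s := s) (h := s * (s / 2)) (by positivity) (by nlinarith)
  set θ := s / 2 with hθ
  have hθ0 : 0 < θ := by positivity
  have hθ1 : θ ≤ 1 / 4 := by linarith
  have c1 := abs_le.1 (h0 s hs (by linarith))
  have c2 := abs_le.1 (h0 (s + s * θ) (by positivity) (by nlinarith))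
  have c3 := abs_le.1 (h0 (s - s * θ) (by nlinarith) (by nlinarith))
  have d0 : Real.pi ^ 2 / (6 * s ^ 2) = P / s ^ 2 := by rw [hP]; field_simp
  have d2 : Real.pi ^ 2 / (6 * (s + s * θ) ^ 2) = P / s ^ 2 * (1 / (1 + θ) ^ 2) := by
    rw [hP]; field_simp
  have d3 : Real.pi ^ 2 / (6 * (s - s * θ) ^ 2) = P / s ^ 2 * (1 / (1 - θ) ^ 2) := by
    have : 0 < 1 - θ := by linarith
    have h : s - s * θ = s * (1 - θ) := by ring
    rw [hP, h]; field_simp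
  have i0 : 1 / (2 * s) = 1 / (2 * s) * 1 := by ring
  have i2 : 1 / (2 * (s + s * θ)) = 1 / (2 * s) * (1 / (1 + θ)) := by field_simp
  have i3 : 1 / (2 * (s - s * θ)) = 1 / (2 * s) * (1 / (1 - θ)) := by
    have : 0 < 1 - θ := by linarith
    have h : s - s * θ = s * (1 - θ) := by ring
    rw [h]; field_simp
  rw [d0] at c1
  rw [d2, i2] at c2
  rw [d3, i3] at c3
  have hPs : 0 < P / s ^ 2 := by positivity
  have hs2 : 0 < 1 / (2 * s) := by positivity
  have j1 : 1 / (1 + θ) ^ 2 ≤ 1 - 2 * θ + 3 * θ ^ 2 := by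
    exact one_div_one_add_sq_le hθ0.le
  have j2 : 1 / (1 - θ) ^ 2 ≤ 1 + 2 * θ + 8 * θ ^ 2 := by
    exact one_div_one_sub_sq_le hθ1
  have j3 : 1 - θ ≤ 1 / (1 + θ) := by
    rw [le_div_iff₀ (by positivity)]
    nlinarith
  have j4 : 1 ≤ 1 / (1 - θ) := by
    rw [le_div_iff₀ (by linarith)]
    linarith
  have k1 := mul_le_mul_of_nonneg_left j1 hPs.le
  have k2 := mul_le_mul_of_nonneg_left j2 hPs.le
  have k3 := mul_le_mul_of_nonneg_left j3 hs2.le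
  have k4 := mul_le_mul_of_nonneg_left j4 hs2.le
  have lo : P / s ^ 2 * (2 * θ - 3 * θ ^ 2) - 1 / (2 * s) * θ - 2 * K ≤
      s * θ * sigmaMoment 1 s := by linarith
  have up : s * θ * sigmaMoment 1 s ≤ P / s ^ 2 * (2 * θ + 8 * θ ^ 2) + 2 * K := by linarith
  have l1 : P / s ^ 2 * (2 * θ - 3 * θ ^ 2) - 1 / (2 * s) * θ - 2 * K =
      s * θ * (Real.pi ^ 2 / (3 * s ^ 3) - (3 / 2 * P + 1 / 2 + 4 * K) / s ^ 2) := by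
    rw [hθ, hP]; field_simp; ring
  have l2 : P / s ^ 2 * (2 * θ + 8 * θ ^ 2) + 2 * K =
      s * θ * (Real.pi ^ 2 / (3 * s ^ 3) + (4 * P + 4 * K) / s ^ 2) := by
    rw [hθ, hP]; field_simp; ring
  rw [l1] at lo
  rw [l2] at up
  have lo' := le_of_mul_le_mul_left lo (by positivity)
  have up' := le_of_mul_le_mul_left up (by positivity)
  have m1 : (3 / 2 * P + 1 / 2 + 4 * K) / s ^ 2 ≤ (4 * P + 1 / 2 + 4 * K) / s ^ 2 := by
    gcongr; norm_num
  have m2 : (4 * P + 4 * K) / s ^ 2 ≤ (4 * P + 1 / 2 + 4 * K) / s ^ 2 := by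
    exact div_le_div_of_nonneg_right (by linarith) (by positivity)
  rw [abs_le]
  constructor <;> linarith

/-- `∑ k ^ 2 σ(k) exp (-s k) = π ^ 2 / s ^ 4 + O(s ^ (-3))`. -/
theorem exists_abs_sigmaMoment_two_sub_le : ∃ K : ℝ, 0 < K ∧ ∀ s : ℝ, 0 < s → s ≤ 1 / 2 →
    |sigmaMoment 2 s - Real.pi ^ 2 / s ^ 4| ≤ K / s ^ 3 := by
  obtain ⟨K, hK, h0⟩ := exists_abs_sigmaMoment_zero_sub_le
  obtain ⟨K4, hK4, h4⟩ := exists_sigmaMoment_le 4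
  set P := Real.pi ^ 2 / 6 with hP
  have hP0 : 0 < P := by positivity
  refine ⟨6 * P + 2 + 16 * K + 16 * K4, by positivity, fun s hs hs1 => ?_⟩
  -- The step is `h = s * θ`, so `h ^ 2 = s ^ 3 / 4`. The `O(1)` remainder divided by `h ^ 2`, the
  -- discretisation error, and the fourth-moment term `h ^ 2 * s ^ (-6)` are then all of order `s ^
  -- (-3)`.
  set θ := Real.sqrt s / 2 with hθ
  have hθ0 : 0 < θ := by positivity
  have hw : θ ^ 2 = s / 4 := by rw [hθ, div_pow, Real.sq_sqrt hs.le]; norm_num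
  have hθ1 : θ ≤ 1 / 2 := by nlinarith
  obtain ⟨b1, b2⟩ := sigmaMoment_two_bounds (s := s) (h := s * θ) (by positivity) (by nlinarith)
  have hpos : 0 < 1 - θ := by linarith
  have hsub : s - s * θ = s * (1 - θ) := by ring
  have c1 := abs_le.1 (h0 s hs (by linarith))
  have c2 := abs_le.1 (h0 (s + s * θ) (by positivity) (by nlinarith))
  have c3 := abs_le.1 (h0 (s - s * θ) (by nlinarith) (by nlinarith))
  have c4 := h4 (s - s * θ) (by nlinarith) (by nlinarith)
  have d0 : Real.pi ^ 2 / (6 * s ^ 2) = P / s ^ 2 := by rw [hP]; field_simp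
  have d2 : Real.pi ^ 2 / (6 * (s + s * θ) ^ 2) = P / s ^ 2 * (1 / (1 + θ) ^ 2) := by
    rw [hP]; field_simp
  have d3 : Real.pi ^ 2 / (6 * (s - s * θ) ^ 2) = P / s ^ 2 * (1 / (1 - θ) ^ 2) := by
    rw [hP, hsub]; field_simp
  have i2 : 1 / (2 * (s + s * θ)) = 1 / (2 * s) * (1 / (1 + θ)) := by field_simp
  have i3 : 1 / (2 * (s - s * θ)) = 1 / (2 * s) * (1 / (1 - θ)) := by
    rw [hsub]; field_simp
  rw [d0] at c1
  rw [d2, i2] at c2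
  rw [d3, i3] at c3
  have hPs : 0 < P / s ^ 2 := by positivity
  have hs2 : 0 < 1 / (2 * s) := by positivity
  have hw1 : θ ^ 2 ≤ 1 / 8 := by linarith
  have hw0 : 0 < θ ^ 2 := by positivity
  have e1 : 1 / (1 - θ) ^ 2 + 1 / (1 + θ) ^ 2 = 2 * (1 + θ ^ 2) / (1 - θ ^ 2) ^ 2 := by
    have : 1 - θ ^ 2 ≠ 0 := by linarith
    have : 1 - θ ^ 2 = (1 - θ) * (1 + θ) := by ring
    rw [this]; field_simp; ring
  have e2 : 1 / (1 - θ) + 1 / (1 + θ) = 2 / (1 - θ ^ 2) := by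
    have : 1 - θ ^ 2 = (1 - θ) * (1 + θ) := by ring
    rw [this]; field_simp; ring
  set w := θ ^ 2 with hwdef
  have j1 : 2 + 6 * w ≤ 1 / (1 - θ) ^ 2 + 1 / (1 + θ) ^ 2 := by
    rw [e1]
    exact le_two_mul_one_add_div hw1
  have j2 : 1 / (1 - θ) ^ 2 + 1 / (1 + θ) ^ 2 ≤ 2 + 6 * w + 24 * w ^ 2 := by
    rw [e1]
    exact two_mul_one_add_div_le hw1
  have j3 : 1 / (1 - θ) + 1 / (1 + θ) ≤ 2 + 4 * w := by
    rw [e2, div_le_iff₀ (by linarith)]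
    have : 0 ≤ w * (2 - 4 * w) := mul_nonneg hw0.le (by linarith)
    linarith
  have j4 : 2 ≤ 1 / (1 - θ) + 1 / (1 + θ) := by
    rw [e2, le_div_iff₀ (by linarith)]
    linarith
  have k1 := mul_le_mul_of_nonneg_left j1 hPs.le
  have k2 := mul_le_mul_of_nonneg_left j2 hPs.le
  have k3 := mul_le_mul_of_nonneg_left j3 hs2.le
  have k4 := mul_le_mul_of_nonneg_left j4 hs2.le
  have hS4 : sigmaMoment 4 (s - s * θ) ≤ 64 * K4 / s ^ 6 := by
    refine c4.trans ?_
    rw [hsub, mul_pow, div_le_div_iff₀ (by positivity) (by positivity)]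
    have : (1 / 2 : ℝ) ^ 6 ≤ (1 - θ) ^ (4 + 2) := by gcongr; linarith
    have h2 := mul_le_mul_of_nonneg_left this (show 0 ≤ 64 * K4 * s ^ 6 by positivity)
    norm_num at h2 ⊢
    linarith
  have k5 := mul_le_mul_of_nonneg_left hS4 (show 0 ≤ (s * θ) ^ 4 by positivity)
  have lo : P / s ^ 2 * (6 * w) - 1 / (2 * s) * (4 * w) - 4 * K - (s * θ) ^ 4 * (64 * K4 / s ^ 6) ≤
      (s * θ) ^ 2 * sigmaMoment 2 s := by linarith
  have up : (s * θ) ^ 2 * sigmaMoment 2 s ≤ P / s ^ 2 * (6 * w + 24 * w ^ 2) + 4 * K := by linarith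
  have q2 : (s * θ) ^ 2 = s ^ 2 * (s / 4) := by rw [mul_pow, ← hwdef, hw]
  have q4 : (s * θ) ^ 4 = (s ^ 2 * (s / 4)) ^ 2 := by rw [← q2]; ring
  have l1 : P / s ^ 2 * (6 * w) - 1 / (2 * s) * (4 * w) - 4 * K -
        (s * θ) ^ 4 * (64 * K4 / s ^ 6) =
      (s * θ) ^ 2 * (Real.pi ^ 2 / s ^ 4 - (2 + 16 * K + 16 * K4) / s ^ 3) := by
    rw [q2, q4, hw, hP]; field_simp; ring
  have l2 : P / s ^ 2 * (6 * w + 24 * w ^ 2) + 4 * K =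
      (s * θ) ^ 2 * (Real.pi ^ 2 / s ^ 4 + (6 * P + 16 * K) / s ^ 3) := by
    rw [q2, hw, hP]; field_simp; ring
  rw [l1] at lo
  rw [l2] at up
  have lo' := le_of_mul_le_mul_left lo (by positivity)
  have up' := le_of_mul_le_mul_left up (by positivity)
  have m1 : (2 + 16 * K + 16 * K4) / s ^ 3 ≤ (6 * P + 2 + 16 * K + 16 * K4) / s ^ 3 := by
    exact div_le_div_of_nonneg_right (by linarith) (by positivity)
  have m2 : (6 * P + 16 * K) / s ^ 3 ≤ (6 * P + 2 + 16 * K + 16 * K4) / s ^ 3 := by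
    exact div_le_div_of_nonneg_right (by linarith) (by positivity)
  rw [abs_le]
  constructor <;> linarith

/-! ### Expansion of the ratio `hrFun (n - k) / hrFun n`. -/

/-- The constant `π √(2/3)` in the exponent of the Hardy–Ramanujan formula. -/
noncomputable def hrConst : ℝ := Real.pi * Real.sqrt (2 / 3)

theorem hrConst_pos : 0 < hrConst := by
  unfold hrConst
  positivity

theorem hrConst_sq : hrConst ^ 2 = 2 * Real.pi ^ 2 / 3 := by
  rw [hrConst, mul_pow, Real.sq_sqrt (by norm_num)]
  ring

theorem hrConst_le_three : hrConst ≤ 3 := by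
  have h := hrConst_sq
  have h1 := Real.pi_lt_d2
  have h2 := Real.pi_pos
  have h3 := hrConst_pos
  nlinarith

theorem sqrt_one_sub_le {u : ℝ} (h0 : 0 ≤ u) (h1 : u ≤ 1) :
    Real.sqrt (1 - u) ≤ 1 - u / 2 - u ^ 2 / 8 := by
  rw [Real.sqrt_le_left (by nlinarith)]
  have : 0 ≤ u ^ 3 * (8 + u) := by positivity
  linarith

theorem le_sqrt_one_sub {u : ℝ} (h0 : 0 ≤ u) (h1 : u ≤ 1) :
    1 - u / 2 - u ^ 2 / 8 - u ^ 3 ≤ Real.sqrt (1 - u) := by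
  rcases le_total (1 - u / 2 - u ^ 2 / 8 - u ^ 3) 0 with h | h
  · exact h.trans (Real.sqrt_nonneg _)
  · apply Real.le_sqrt_of_sq_le
    have hp : 3 / 8 ≤ 1 - u / 2 - u ^ 2 / 8 := by nlinarith
    have h2 : 0 ≤ u ^ 3 := by positivity
    have h3 := mul_nonneg h2 h
    have h4 := mul_le_mul_of_nonneg_left hp h2
    have h5 : 0 ≤ u ^ 3 * (1 - u) := mul_nonneg h2 (by linarith)
    nlinarith

theorem exp_neg_le_one_sub_add_sq_div_two {x : ℝ} (hx : 0 ≤ x) :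
    Real.exp (-x) ≤ 1 - x + x ^ 2 / 2 := by
  have h1 := Real.quadratic_le_exp_of_nonneg hx
  rw [Real.exp_neg, inv_le_iff_one_le_mul₀ (Real.exp_pos x)]
  have h2 : 0 < 1 - x + x ^ 2 / 2 := by nlinarith [sq_nonneg (x - 1)]
  have h3 := mul_le_mul_of_nonneg_left h1 h2.le
  have h4 : 0 ≤ x ^ 4 := by positivity
  linarith

theorem exp_sqrt_sub_le {y u : ℝ} (hy : 0 < y) (h0 : 0 ≤ u) (h1 : u ≤ 1) :
    Real.exp (hrConst * (y * Real.sqrt (1 - u)) - hrConst * y) ≤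
      Real.exp (-(hrConst * y * u / 2)) * Real.exp (-(hrConst * y * u ^ 2 / 8)) := by
  have hc := hrConst_pos
  rw [← Real.exp_add]
  apply Real.exp_le_exp.2
  have := mul_le_mul_of_nonneg_left (sqrt_one_sub_le h0 h1) (show 0 ≤ hrConst * y by positivity)
  linarith

/-- Away from `u = 0` the denominator can be as small as `y ^ (-2)`, but `exp (-(c * y / 32))`, with
`c` = `hrConst`, beats `y ^ 2`. -/
theorem exp_neg_div_one_sub_le {y u : ℝ} (hy : 0 < y) (h : 1 / 2 ≤ u) (h1 : u < 1)
    (h2 : 1 ≤ y ^ 2 * (1 - u)) :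
    Real.exp (-(hrConst * y * u ^ 2 / 8)) / (1 - u) ≤ 2 * 32 ^ 2 / hrConst ^ 2 := by
  have hc := hrConst_pos
  set c := hrConst
  have h1u : 0 < 1 - u := by linarith
  have i1 : Real.exp (-(c * y * u ^ 2 / 8)) / (1 - u) ≤ y ^ 2 * Real.exp (-(c * y / 32)) := by
    rw [div_le_iff₀ h1u]
    have j1 : Real.exp (-(c * y * u ^ 2 / 8)) ≤ Real.exp (-(c * y / 32)) := by
      apply Real.exp_le_exp.2
      have : (1 / 4 : ℝ) ≤ u ^ 2 := by nlinarith
      have := mul_le_mul_of_nonneg_left this (show 0 ≤ c * y / 8 by positivity)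
      linarith
    have j2 := mul_le_mul_of_nonneg_left h2 (Real.exp_pos (-(c * y / 32))).le
    linarith
  refine i1.trans ?_
  rw [Real.exp_neg, ← div_eq_mul_inv, div_le_div_iff₀ (Real.exp_pos _) (by positivity)]
  have h3 := Real.quadratic_le_exp_of_nonneg (show 0 ≤ c * y / 32 by positivity)
  have h4 : 0 ≤ c * y / 32 := by positivity
  linarith

theorem exp_sqrt_ratio_le {y u : ℝ} (hy : 0 < y) (h0 : 0 ≤ u) (h1 : u < 1)
    (h2 : 1 ≤ y ^ 2 * (1 - u)) :
    Real.exp (hrConst * (y * Real.sqrt (1 - u)) - hrConst * y) / (1 - u) ≤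
      (2 + 2 * 32 ^ 2 / hrConst ^ 2) * Real.exp (-(hrConst * y * u / 2)) := by
  have hc := hrConst_pos
  have h1u : 0 < 1 - u := by linarith
  have hK : 0 < 2 * 32 ^ 2 / hrConst ^ 2 := by positivity
  have key : Real.exp (-(hrConst * y * u ^ 2 / 8)) / (1 - u) ≤ 2 + 2 * 32 ^ 2 / hrConst ^ 2 := by
    rcases le_total u (1 / 2) with h | h
    · have h3 : Real.exp (-(hrConst * y * u ^ 2 / 8)) ≤ 1 :=
        Real.exp_le_one_iff.2 (neg_nonpos.2 (by positivity))
      have h4 : Real.exp (-(hrConst * y * u ^ 2 / 8)) / (1 - u) ≤ 2 := by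
        rw [div_le_iff₀ h1u]
        linarith
      linarith
    · linarith [exp_neg_div_one_sub_le hy h h1 h2]
  calc _ ≤ Real.exp (-(hrConst * y * u / 2)) * Real.exp (-(hrConst * y * u ^ 2 / 8)) / (1 - u) :=
        div_le_div_of_nonneg_right (exp_sqrt_sub_le hy h0 h1.le) h1u.le
    _ = Real.exp (-(hrConst * y * u ^ 2 / 8)) / (1 - u) * Real.exp (-(hrConst * y * u / 2)) := by
        ring
    _ ≤ _ := mul_le_mul_of_nonneg_right key (Real.exp_pos _).le

/-- The relevant scale is `u ≈ 1 / y`, with the weights `σ(k)` summing to order `y ^ 2`. Terms of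
size `u` and `y * u ^ 2` must therefore be exact, while `u ^ 2` and `(y * u ^ 2) ^ 2` contribute
only `O(1)` and may carry any constant. -/
theorem exp_sqrt_ratio_upper {y u : ℝ} (hy : 0 < y) (h0 : 0 ≤ u) (h1 : u < 1)
    (h2 : 1 ≤ y ^ 2 * (1 - u)) :
    Real.exp (hrConst * (y * Real.sqrt (1 - u)) - hrConst * y) / (1 - u) ≤
      Real.exp (-(hrConst * y * u / 2)) * (1 + u - hrConst * y * u ^ 2 / 8 +
        (hrConst * y * u ^ 2 / 8) ^ 2 + (2 + 8 * 32 ^ 2 / hrConst ^ 2) * u ^ 2) := by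
  have hc := hrConst_pos
  set c := hrConst
  set x := c * y * u ^ 2 / 8 with hx
  have hx0 : 0 ≤ x := by positivity
  have h1u : 0 < 1 - u := by linarith
  have e1 := exp_sqrt_sub_le hy h0 h1.le
  have e2 : Real.exp (-x) ≤ 1 - x + x ^ 2 / 2 := exp_neg_le_one_sub_add_sq_div_two hx0
  have e3 : Real.exp (-x) ≤ 1 := Real.exp_le_one_iff.2 (by linarith)
  have key : Real.exp (-x) / (1 - u) ≤ 1 + u - x + x ^ 2 + (2 + 8 * 32 ^ 2 / c ^ 2) * u ^ 2 := by
    have hK : 0 ≤ 8 * 32 ^ 2 / c ^ 2 * u ^ 2 := by positivity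
    rcases le_total u (1 / 2) with h | h
    · rw [div_le_iff₀ h1u]
      have i1 : 1 ≤ (1 - u) * (1 + u + 2 * u ^ 2) := by nlinarith [mul_nonneg (sq_nonneg u) (sub_nonneg.2 h)]
      have i2 : Real.exp (-x) * (1 + u + 2 * u ^ 2) ≤ 1 + u - x + x ^ 2 + 2 * u ^ 2 := by
        have j1 := mul_le_mul_of_nonneg_right e2 (show 0 ≤ 1 + u by linarith)
        have j2 := mul_le_mul_of_nonneg_right e3 (show 0 ≤ 2 * u ^ 2 by positivity)
        nlinarith [mul_nonneg hx0 h0, mul_nonneg (sq_nonneg x) h1u.le]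
      have i3 := mul_le_mul_of_nonneg_left i1 (Real.exp_pos (-x)).le
      have i4 := mul_le_mul_of_nonneg_right i2 h1u.le
      have i5 : 0 ≤ 8 * 32 ^ 2 / c ^ 2 * u ^ 2 * (1 - u) := by positivity
      nlinarith
    · have i1 := exp_neg_div_one_sub_le hy h h1 h2
      -- For `u ≥ 1 / 2` the crude bound is hidden in the `u ^ 2` term, which explains the factor `8
      -- = 4 * 2` in the statement.
      have i3 : 2 * 32 ^ 2 / c ^ 2 ≤ 8 * 32 ^ 2 / c ^ 2 * u ^ 2 := by
        have j1 : (1 / 4 : ℝ) ≤ u ^ 2 := by nlinarith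
        have := mul_le_mul_of_nonneg_left j1 (show 0 ≤ 8 * 32 ^ 2 / c ^ 2 by positivity)
        calc _ = 8 * 32 ^ 2 / c ^ 2 * (1 / 4) := by ring
          _ ≤ _ := this
      nlinarith [sq_nonneg (x - 1), sq_nonneg x, sq_nonneg u]
  calc _ ≤ Real.exp (-(c * y * u / 2)) * Real.exp (-x) / (1 - u) := by gcongr
    _ = Real.exp (-(c * y * u / 2)) * (Real.exp (-x) / (1 - u)) := by ring
    _ ≤ _ := by gcongr

/-- The first form drops the term `u`; it serves sums carrying an additional weight `u`, where one
order less of precision suffices. -/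
theorem exp_sqrt_ratio_lower {y u : ℝ} (hy : 0 < y) (h0 : 0 ≤ u) (h1 : u < 1) :
    Real.exp (-(hrConst * y * u / 2)) * (1 - hrConst * y * u ^ 2 / 8 - hrConst * y * u ^ 3) ≤
      Real.exp (hrConst * (y * Real.sqrt (1 - u)) - hrConst * y) / (1 - u) ∧
    Real.exp (-(hrConst * y * u / 2)) *
      (1 + u - hrConst * y * u ^ 2 / 8 - 3 * hrConst * y * u ^ 3) ≤
      Real.exp (hrConst * (y * Real.sqrt (1 - u)) - hrConst * y) / (1 - u) := by
  have hc := hrConst_pos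
  set c := hrConst
  set x := c * y * u ^ 2 / 8 with hx
  set z := c * y * u ^ 3 with hz
  have hz0 : 0 ≤ z := by positivity
  have h1u : 0 < 1 - u := by linarith
  have e1 : Real.exp (-(c * y * u / 2)) * Real.exp (-x - z) ≤
      Real.exp (c * (y * Real.sqrt (1 - u)) - c * y) := by
    rw [← Real.exp_add]
    apply Real.exp_le_exp.2
    have := mul_le_mul_of_nonneg_left (le_sqrt_one_sub h0 h1.le) (show 0 ≤ c * y by positivity)
    rw [hx, hz]
    linarith
  have e2 : 1 - x - z ≤ Real.exp (-x - z) := by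
    linarith [Real.add_one_le_exp (-x - z)]
  have e3 : Real.exp (-x - z) * (1 + u) ≤ Real.exp (-x - z) / (1 - u) := by
    rw [le_div_iff₀ h1u]
    have := Real.exp_pos (-x - z)
    nlinarith [sq_nonneg u]
  have e4 : Real.exp (-(c * y * u / 2)) * (Real.exp (-x - z) / (1 - u)) ≤
      Real.exp (c * (y * Real.sqrt (1 - u)) - c * y) / (1 - u) := by
    rw [← mul_div_assoc]
    gcongr
  have e5 : (1 - x - z) * (1 + u) ≤ Real.exp (-x - z) * (1 + u) :=
    mul_le_mul_of_nonneg_right e2 (by linarith)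
  refine ⟨le_trans ?_ e4, le_trans ?_ e4⟩
  · gcongr
    have := Real.exp_pos (-x - z)
    nlinarith
  · gcongr
    have h5 : u * x = z / 8 := by rw [hx, hz]; ring
    have h6 : u * z ≤ z := mul_le_of_le_one_left hz0 h1.le
    have h7 : 3 * c * y * u ^ 3 = 3 * z := by rw [hz]; ring
    rw [h7]
    nlinarith

/-- The shape `exp (π √(2 n / 3)) / n` of the Hardy–Ramanujan formula, shifted by two. -/
noncomputable def hrFun (m : ℕ) : ℝ := Real.exp (hrConst * Real.sqrt (m + 2)) / (m + 2)

theorem hrFun_pos (m : ℕ) : 0 < hrFun m := by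
  unfold hrFun
  positivity

theorem hrFun_ratio {n k : ℕ} (h : k ≤ n) {y u : ℝ} (hy : y = Real.sqrt (n + 2))
    (hu : u = k / (n + 2 : ℝ)) :
    hrFun (n - k) / hrFun n =
      Real.exp (hrConst * (y * Real.sqrt (1 - u)) - hrConst * y) / (1 - u) := by
  have h1 : ((n - k : ℕ) : ℝ) + 2 = (n + 2) * (1 - u) := by
    rw [Nat.cast_sub h, hu]
    field_simp
    ring
  have hk : (k : ℝ) ≤ n := by exact_mod_cast h
  have h2 : 0 < 1 - u := by
    rw [hu, sub_pos, div_lt_one (by positivity)]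
    linarith
  rw [hrFun, hrFun, h1, Real.sqrt_mul (by positivity), ← hy, Real.exp_sub]
  field_simp

/-- The three pieces are `y ^ 2 - y / c`, `4 * y / c` and `3 * y / c` up to `O(1)`, where `c` =
`hrConst`. The terms of order `y` cancel since `-1 + 4 - 3 = 0`, which is what singles out the
denominator `m + 2`, to the first power, in `hrFun`. -/
theorem exists_moment_combination_le : ∃ K : ℝ, 0 < K ∧ ∀ y s : ℝ, 3 ≤ y →
    s = hrConst / (2 * y) →
    |sigmaMoment 0 s + sigmaMoment 1 s / y ^ 2 - hrConst / (8 * y ^ 3) * sigmaMoment 2 s - y ^ 2|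
      ≤ K ∧ |sigmaMoment 1 s / y ^ 2 - 4 * y / hrConst| ≤ K := by
  obtain ⟨K0, hK0, h0⟩ := exists_abs_sigmaMoment_zero_sub_le
  obtain ⟨K1, hK1, h1⟩ := exists_abs_sigmaMoment_one_sub_le
  obtain ⟨K2, hK2, h2⟩ := exists_abs_sigmaMoment_two_sub_le
  have hc := hrConst_pos
  have hc3 := hrConst_le_three
  have hc2 : Real.pi ^ 2 = 3 * hrConst ^ 2 / 2 := by rw [hrConst_sq]; ring
  refine ⟨K0 + 4 * K1 / hrConst ^ 2 + K2 / hrConst ^ 2, by positivity, fun y s hy hs => ?_⟩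
  have hy0 : 0 < y := by linarith
  have hs0 : 0 < s := by rw [hs]; positivity
  have hs1 : s ≤ 1 / 2 := by
    rw [hs, div_le_iff₀ (by positivity)]
    linarith
  have a0 := abs_le.1 (h0 s hs0 (by linarith))
  have a1 := abs_le.1 (h1 s hs0 hs1)
  have a2 := abs_le.1 (h2 s hs0 hs1)
  have m0 : Real.pi ^ 2 / (6 * s ^ 2) - 1 / (2 * s) = y ^ 2 - y / hrConst := by
    rw [hc2, hs]; field_simp; ring
  have m1 : Real.pi ^ 2 / (3 * s ^ 3) = 4 * y / hrConst * y ^ 2 := by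
    rw [hc2, hs]; field_simp; ring
  have m2 : Real.pi ^ 2 / s ^ 4 = 3 * y / hrConst * (8 * y ^ 3 / hrConst) := by
    rw [hc2, hs]; field_simp; ring
  have k1 : K1 / s ^ 2 = 4 * K1 / hrConst ^ 2 * y ^ 2 := by
    rw [hs]; field_simp; ring
  have k2 : K2 / s ^ 3 = K2 / hrConst ^ 2 * (8 * y ^ 3 / hrConst) := by
    rw [hs]; field_simp; ring
  rw [m0] at a0
  rw [m1, k1] at a1
  rw [m2, k2] at a2
  have b1 : -(4 * K1 / hrConst ^ 2) ≤ sigmaMoment 1 s / y ^ 2 - 4 * y / hrConst ∧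
      sigmaMoment 1 s / y ^ 2 - 4 * y / hrConst ≤ 4 * K1 / hrConst ^ 2 := by
    have hd : sigmaMoment 1 s / y ^ 2 - 4 * y / hrConst =
        (sigmaMoment 1 s - 4 * y / hrConst * y ^ 2) / y ^ 2 := by field_simp
    rw [hd, le_div_iff₀ (by positivity), div_le_iff₀ (by positivity)]
    exact ⟨by linarith [a1.1], a1.2⟩
  have b2 : -(K2 / hrConst ^ 2) ≤ hrConst / (8 * y ^ 3) * sigmaMoment 2 s - 3 * y / hrConst ∧
      hrConst / (8 * y ^ 3) * sigmaMoment 2 s - 3 * y / hrConst ≤ K2 / hrConst ^ 2 := by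
    have hd : hrConst / (8 * y ^ 3) * sigmaMoment 2 s - 3 * y / hrConst =
        (sigmaMoment 2 s - 3 * y / hrConst * (8 * y ^ 3 / hrConst)) / (8 * y ^ 3 / hrConst) := by
      field_simp
    rw [hd, le_div_iff₀ (by positivity), div_le_iff₀ (by positivity)]
    exact ⟨by linarith [a2.1], a2.2⟩
  have p1 : 0 < 4 * K1 / hrConst ^ 2 := by positivity
  have p2 : 0 < K2 / hrConst ^ 2 := by positivity
  have r1 : 3 * y / hrConst = 3 * (y / hrConst) := by ring
  have r2 : 4 * y / hrConst = 4 * (y / hrConst) := by ring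
  rw [r2] at b1 ⊢
  rw [r1] at b2
  rw [abs_le, abs_le]
  refine ⟨⟨?_, ?_⟩, ?_, ?_⟩ <;> linarith [a0.1, a0.2, b1.1, b1.2, b2.1, b2.2]

theorem hasSum_ite_Icc (n : ℕ) (f : ℕ → ℝ) :
    HasSum (fun k => if k ∈ Finset.Icc 1 n then f k else 0) (∑ k ∈ Finset.Icc 1 n, f k) := by
  have h : HasSum _ _ := hasSum_sum_of_ne_finset_zero (f := fun k => if k ∈ Finset.Icc 1 n then f k else 0)
    (s := Finset.Icc 1 n) (L := .unconditional ℕ) (fun b hb => if_neg hb)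
  rwa [Finset.sum_ite_mem, Finset.inter_self] at h

theorem ratio_param {n k : ℕ} {y : ℝ} (hy : y = Real.sqrt (n + 2)) (hk : k ≤ n) :
    0 ≤ (k : ℝ) / (n + 2) ∧ (k : ℝ) / (n + 2) < 1 ∧ 1 ≤ y ^ 2 * (1 - (k : ℝ) / (n + 2)) := by
  have hk' : (k : ℝ) ≤ n := by exact_mod_cast hk
  have hy2 : y ^ 2 = n + 2 := by rw [hy, Real.sq_sqrt (by positivity)]
  refine ⟨by positivity, ?_, ?_⟩
  · rw [div_lt_one (by positivity)]
    linarith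
  · rw [hy2, mul_sub, mul_div_cancel₀ _ (by positivity)]
    linarith

/-- Together with `exists_le_sum_sigma_ratio` this says that `hrFun` satisfies Euler's recurrence up
to a bounded multiple of `hrFun n`. -/
theorem exists_sum_sigma_ratio_le : ∃ K : ℝ, 0 < K ∧ ∀ n : ℕ, 3 ≤ Real.sqrt (n + 2) →
    ∑ k ∈ Finset.Icc 1 n, (ArithmeticFunction.sigma 1 k : ℝ) * (hrFun (n - k) / hrFun n) ≤
      n + 2 + K := by
  obtain ⟨K0, hK0, h0⟩ := exists_moment_combination_le
  obtain ⟨K2, hK2, h2⟩ := exists_sigmaMoment_le 2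
  obtain ⟨K4, hK4, h4⟩ := exists_sigmaMoment_le 4
  have hc := hrConst_pos
  have hc3 := hrConst_le_three
  set K' := 2 + 8 * 32 ^ 2 / hrConst ^ 2 with hK'
  have hK'0 : 0 < K' := by positivity
  refine ⟨K0 + K4 / hrConst ^ 4 + K' * (16 * K2 / hrConst ^ 4), by positivity, fun n hn => ?_⟩
  set y := Real.sqrt (n + 2) with hy
  have hy0 : 0 < y := by linarith
  have hy2 : (n : ℝ) + 2 = y ^ 2 := by rw [hy, Real.sq_sqrt (by positivity)]
  set s := hrConst / (2 * y) with hs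
  have hs0 : 0 < s := by positivity
  have hs1 : s ≤ 1 := by rw [hs, div_le_one (by positivity)]; linarith
  have H := ((((hasSum_sigmaMoment 0 hs0).add ((hasSum_sigmaMoment 1 hs0).div_const (y ^ 2))).sub
    ((hasSum_sigmaMoment 2 hs0).mul_left (hrConst / (8 * y ^ 3)))).add
    ((hasSum_sigmaMoment 4 hs0).mul_left (hrConst ^ 2 / (64 * y ^ 6)))).add
    ((hasSum_sigmaMoment 2 hs0).mul_left (K' / y ^ 4))
  have hle := hasSum_le (fun k => ?_) (hasSum_ite_Icc n fun k =>
    (ArithmeticFunction.sigma 1 k : ℝ) * (hrFun (n - k) / hrFun n)) H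
  · have b0 := (abs_le.1 (h0 y s hn hs).1).2
    have b2 := mul_le_mul_of_nonneg_left (h2 s hs0 hs1) (show 0 ≤ K' / y ^ 4 by positivity)
    have b4 := mul_le_mul_of_nonneg_left (h4 s hs0 hs1)
      (show 0 ≤ hrConst ^ 2 / (64 * y ^ 6) by positivity)
    have c2 : K' / y ^ 4 * (K2 / s ^ (2 + 2)) = K' * (16 * K2 / hrConst ^ 4) := by
      conv_lhs => rw [show 2 + 2 = 4 from rfl, hs]
      field_simp; ring
    have c4 : hrConst ^ 2 / (64 * y ^ 6) * (K4 / s ^ (4 + 2)) = K4 / hrConst ^ 4 := by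
      conv_lhs => rw [show 4 + 2 = 6 from rfl, hs]
      field_simp; ring
    rw [c2] at b2
    rw [c4] at b4
    rw [hy2]
    linarith
  · set u := (k : ℝ) / (n + 2) with hu
    have hu' : u = k / y ^ 2 := by rw [hu, hy2]
    have hexp : Real.exp (-s * k) = Real.exp (-(hrConst * y * u / 2)) := by
      congr 1
      rw [hs, hu']; field_simp
    have hR : (k : ℝ) ^ 0 * (ArithmeticFunction.sigma 1 k : ℝ) * Real.exp (-s * k) +
        (k : ℝ) ^ 1 * (ArithmeticFunction.sigma 1 k : ℝ) * Real.exp (-s * k) / y ^ 2 -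
        hrConst / (8 * y ^ 3) *
          ((k : ℝ) ^ 2 * (ArithmeticFunction.sigma 1 k : ℝ) * Real.exp (-s * k)) +
        hrConst ^ 2 / (64 * y ^ 6) *
          ((k : ℝ) ^ 4 * (ArithmeticFunction.sigma 1 k : ℝ) * Real.exp (-s * k)) +
        K' / y ^ 4 * ((k : ℝ) ^ 2 * (ArithmeticFunction.sigma 1 k : ℝ) * Real.exp (-s * k)) =
        (ArithmeticFunction.sigma 1 k : ℝ) * (Real.exp (-(hrConst * y * u / 2)) *
          (1 + u - hrConst * y * u ^ 2 / 8 + (hrConst * y * u ^ 2 / 8) ^ 2 + K' * u ^ 2)) := by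
      rw [hexp, hu']
      generalize Real.exp _ = E
      field_simp
      ring
    rw [hR]
    split_ifs with h
    · have hk := (Finset.mem_Icc.1 h).2
      obtain ⟨p0, p1, p2⟩ := ratio_param hy hk
      rw [hrFun_ratio hk hy hu]
      exact mul_le_mul_of_nonneg_left (exp_sqrt_ratio_upper hy0 p0 p1 p2) (by positivity)
    -- Extending the sum to all `k` is harmless because the majorant is nonnegative: `1 - x + x ^ 2
    -- > 0` for `x = c * y * u ^ 2 / 8`, with `c` = `hrConst`.
    · have hu0 : 0 ≤ u := by positivity
      have h1 := sq_nonneg (hrConst * y * u ^ 2 / 8 - 1)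
      have h2 := sq_nonneg (hrConst * y * u ^ 2 / 8)
      have h3 : 0 ≤ K' * u ^ 2 := by positivity
      have : 0 ≤ 1 + u - hrConst * y * u ^ 2 / 8 + (hrConst * y * u ^ 2 / 8) ^ 2 + K' * u ^ 2 := by
        nlinarith
      positivity

theorem half_le_of_not_mem_Icc {n k : ℕ} (hk0 : k ≠ 0) (h : k ∉ Finset.Icc 1 n)
    (hn : 0 < n) : 1 / 2 ≤ (k : ℝ) / (n + 2) := by
  have h1 : n + 1 ≤ k := by
    rw [Finset.mem_Icc] at h
    omega
  have h1' : (n : ℝ) + 1 ≤ k := by exact_mod_cast h1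
  have h2 : (0 : ℝ) < n := by exact_mod_cast hn
  rw [le_div_iff₀ (by positivity)]
  linarith

theorem exists_le_sum_sigma_ratio : ∃ K : ℝ, 0 < K ∧ ∀ n : ℕ, 3 ≤ Real.sqrt (n + 2) →
    (n : ℝ) + 2 - K ≤
      ∑ k ∈ Finset.Icc 1 n, (ArithmeticFunction.sigma 1 k : ℝ) * (hrFun (n - k) / hrFun n) := by
  obtain ⟨K0, hK0, h0⟩ := exists_moment_combination_le
  obtain ⟨K2, hK2, h2⟩ := exists_sigmaMoment_le 2
  obtain ⟨K3, hK3, h3⟩ := exists_sigmaMoment_le 3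
  have hc := hrConst_pos
  have hc3 := hrConst_le_three
  refine ⟨K0 + 96 * K3 / hrConst ^ 4 + 6 * (16 * K2 / hrConst ^ 4), by positivity,
    fun n hn => ?_⟩
  set y := Real.sqrt (n + 2) with hy
  have hy0 : 0 < y := by linarith
  have hy2 : (n : ℝ) + 2 = y ^ 2 := by rw [hy, Real.sq_sqrt (by positivity)]
  have hn0 : 0 < n := by
    by_contra! hn0
    have : n = 0 := by omega
    subst this
    norm_num at hy2
    nlinarith
  set s := hrConst / (2 * y) with hs
  have hs0 : 0 < s := by positivity
  have hs1 : s ≤ 1 := by rw [hs, div_le_one (by positivity)]; linarith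
  -- The last summand, `-6 * u ^ 2` in the bracket, makes the minorant nonpositive for `k > n`,
  -- where `u ≥ 1 / 2` and hence `1 + u ≤ 6 * u ^ 2`; it costs only `O(1)`.
  have H := ((((hasSum_sigmaMoment 0 hs0).add ((hasSum_sigmaMoment 1 hs0).div_const (y ^ 2))).sub
    ((hasSum_sigmaMoment 2 hs0).mul_left (hrConst / (8 * y ^ 3)))).sub
    ((hasSum_sigmaMoment 3 hs0).mul_left (3 * hrConst / y ^ 5))).sub
    ((hasSum_sigmaMoment 2 hs0).mul_left (6 / y ^ 4))
  have hle := hasSum_le (fun k => ?_) H (hasSum_ite_Icc n fun k =>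
    (ArithmeticFunction.sigma 1 k : ℝ) * (hrFun (n - k) / hrFun n))
  · have b0 := (abs_le.1 (h0 y s hn hs).1).1
    have b2 := mul_le_mul_of_nonneg_left (h2 s hs0 hs1) (show 0 ≤ 6 / y ^ 4 by positivity)
    have b3 := mul_le_mul_of_nonneg_left (h3 s hs0 hs1)
      (show 0 ≤ 3 * hrConst / y ^ 5 by positivity)
    have c2 : 6 / y ^ 4 * (K2 / s ^ (2 + 2)) = 6 * (16 * K2 / hrConst ^ 4) := by
      conv_lhs => rw [show 2 + 2 = 4 from rfl, hs]
      field_simp; ring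
    have c3 : 3 * hrConst / y ^ 5 * (K3 / s ^ (3 + 2)) = 96 * K3 / hrConst ^ 4 := by
      conv_lhs => rw [show 3 + 2 = 5 from rfl, hs]
      field_simp; ring
    rw [c2] at b2
    rw [c3] at b3
    rw [hy2]
    linarith
  · set u := (k : ℝ) / (n + 2) with hu
    have hu' : u = k / y ^ 2 := by rw [hu, hy2]
    have hexp : Real.exp (-s * k) = Real.exp (-(hrConst * y * u / 2)) := by
      congr 1
      rw [hs, hu']; field_simp
    have hR : (k : ℝ) ^ 0 * (ArithmeticFunction.sigma 1 k : ℝ) * Real.exp (-s * k) +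
        (k : ℝ) ^ 1 * (ArithmeticFunction.sigma 1 k : ℝ) * Real.exp (-s * k) / y ^ 2 -
        hrConst / (8 * y ^ 3) *
          ((k : ℝ) ^ 2 * (ArithmeticFunction.sigma 1 k : ℝ) * Real.exp (-s * k)) -
        3 * hrConst / y ^ 5 *
          ((k : ℝ) ^ 3 * (ArithmeticFunction.sigma 1 k : ℝ) * Real.exp (-s * k)) -
        6 / y ^ 4 * ((k : ℝ) ^ 2 * (ArithmeticFunction.sigma 1 k : ℝ) * Real.exp (-s * k)) =
        (ArithmeticFunction.sigma 1 k : ℝ) * (Real.exp (-(hrConst * y * u / 2)) *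
          (1 + u - hrConst * y * u ^ 2 / 8 - 3 * hrConst * y * u ^ 3 - 6 * u ^ 2)) := by
      rw [hexp, hu']
      generalize Real.exp _ = E
      field_simp
    rw [hR]
    have hu0 : 0 ≤ u := by positivity
    split_ifs with h
    · have hk := (Finset.mem_Icc.1 h).2
      obtain ⟨p0, p1, p2⟩ := ratio_param hy hk
      rw [hrFun_ratio hk hy hu]
      refine mul_le_mul_of_nonneg_left (le_trans ?_ (exp_sqrt_ratio_lower hy0 p0 p1).2)
        (by positivity)
      refine mul_le_mul_of_nonneg_left ?_ (Real.exp_pos _).le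
      rw [← hu]
      linarith [sq_nonneg u]
    · by_cases hk0 : k = 0
      · simp [hk0]
      have h1 : 1 / 2 ≤ u := half_le_of_not_mem_Icc hk0 h hn0
      have h2 : 0 ≤ hrConst * y * u ^ 2 / 8 := by positivity
      have h3 : 0 ≤ 3 * hrConst * y * u ^ 3 := by positivity
      have : 1 + u - hrConst * y * u ^ 2 / 8 - 3 * hrConst * y * u ^ 3 - 6 * u ^ 2 ≤ 0 := by
        nlinarith
      exact mul_nonpos_of_nonneg_of_nonpos (by positivity)
        (mul_nonpos_of_nonneg_of_nonpos (by positivity) this)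

/-- This sum measures what a perturbation of `hrFun` gains in the recurrence: a quantity of order
`√n`, to be set against the bounded defect of `hrFun`. -/
theorem exists_le_sum_sigma_ratio_mul : ∃ K : ℝ, 0 < K ∧ ∀ n : ℕ, 3 ≤ Real.sqrt (n + 2) →
    4 * Real.sqrt (n + 2) / hrConst - K ≤
      ∑ k ∈ Finset.Icc 1 n, (ArithmeticFunction.sigma 1 k : ℝ) *
        (hrFun (n - k) / hrFun n * ((k : ℝ) / (n + 2))) := by
  obtain ⟨K0, hK0, h0⟩ := exists_moment_combination_le
  obtain ⟨K3, hK3, h3⟩ := exists_sigmaMoment_le 3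
  have hc := hrConst_pos
  have hc3 := hrConst_le_three
  refine ⟨K0 + (9 / 8 * hrConst + 4) * (32 * K3 / hrConst ^ 5), by positivity, fun n hn => ?_⟩
  set y := Real.sqrt (n + 2) with hy
  have hy0 : 0 < y := by linarith
  have hy2 : (n : ℝ) + 2 = y ^ 2 := by rw [hy, Real.sq_sqrt (by positivity)]
  have hn0 : 0 < n := by
    by_contra! hn0
    have : n = 0 := by omega
    subst this
    norm_num at hy2
    nlinarith
  set s := hrConst / (2 * y) with hs
  have hs0 : 0 < s := by positivity
  have hs1 : s ≤ 1 := by rw [hs, div_le_one (by positivity)]; linarith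
  -- Here `9 / 8 = 1 / 8 + 1` merges the two error terms by `u ^ 3 ≤ u ^ 2`, and the extra `4` makes
  -- the minorant nonpositive for `k > n`, since `4 * y * u ^ 2 ≥ 1` there.
  have H := ((hasSum_sigmaMoment 1 hs0).div_const (y ^ 2)).sub
    ((hasSum_sigmaMoment 3 hs0).mul_left ((9 / 8 * hrConst + 4) / y ^ 5))
  have hle := hasSum_le (fun k => ?_) H (hasSum_ite_Icc n fun k =>
    (ArithmeticFunction.sigma 1 k : ℝ) * (hrFun (n - k) / hrFun n * ((k : ℝ) / (n + 2))))
  · have b0 := (abs_le.1 (h0 y s hn hs).2).1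
    have b3 := mul_le_mul_of_nonneg_left (h3 s hs0 hs1)
      (show 0 ≤ (9 / 8 * hrConst + 4) / y ^ 5 by positivity)
    have c3 : (9 / 8 * hrConst + 4) / y ^ 5 * (K3 / s ^ (3 + 2)) =
        (9 / 8 * hrConst + 4) * (32 * K3 / hrConst ^ 5) := by
      conv_lhs => rw [show 3 + 2 = 5 from rfl, hs]
      field_simp; ring
    rw [c3] at b3
    linarith
  · set u := (k : ℝ) / (n + 2) with hu
    have hu' : u = k / y ^ 2 := by rw [hu, hy2]
    have hexp : Real.exp (-s * k) = Real.exp (-(hrConst * y * u / 2)) := by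
      congr 1
      rw [hs, hu']; field_simp
    have hR : (k : ℝ) ^ 1 * (ArithmeticFunction.sigma 1 k : ℝ) * Real.exp (-s * k) / y ^ 2 -
        (9 / 8 * hrConst + 4) / y ^ 5 *
          ((k : ℝ) ^ 3 * (ArithmeticFunction.sigma 1 k : ℝ) * Real.exp (-s * k)) =
        (ArithmeticFunction.sigma 1 k : ℝ) * (Real.exp (-(hrConst * y * u / 2)) *
          ((1 - (9 / 8 * hrConst + 4) * y * u ^ 2) * u)) := by
      rw [hexp, hu']
      generalize Real.exp _ = E
      field_simp
    rw [hR]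
    have hu0 : 0 ≤ u := by positivity
    split_ifs with h
    · have hk := (Finset.mem_Icc.1 h).2
      obtain ⟨p0, p1, p2⟩ := ratio_param hy hk
      rw [hrFun_ratio hk hy hu, ← mul_assoc (Real.exp _)]
      refine mul_le_mul_of_nonneg_left (mul_le_mul_of_nonneg_right
        (le_trans ?_ (exp_sqrt_ratio_lower hy0 p0 p1).1) hu0) (by positivity)
      refine mul_le_mul_of_nonneg_left ?_ (Real.exp_pos _).le
      rw [← hu] at p1 ⊢
      have h1 : hrConst * y * u ^ 3 ≤ hrConst * y * u ^ 2 := by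
        have : u ^ 3 ≤ u ^ 2 := pow_le_pow_of_le_one hu0 p1.le (by norm_num)
        gcongr
      have h2 : 0 ≤ y * u ^ 2 := by positivity
      linarith
    · by_cases hk0 : k = 0
      · simp [hk0]
      have h1 : 1 / 2 ≤ u := half_le_of_not_mem_Icc hk0 h hn0
      have h2 : 0 ≤ hrConst * (y * u ^ 2) := by positivity
      have h3 : 1 ≤ 4 * (y * u ^ 2) := by
        have h4 : 1 / 4 ≤ u ^ 2 := by nlinarith
        nlinarith
      have : 1 - (9 / 8 * hrConst + 4) * y * u ^ 2 ≤ 0 := by nlinarith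
      exact mul_nonpos_of_nonneg_of_nonpos (by positivity)
        (mul_nonpos_of_nonneg_of_nonpos (by positivity)
          (mul_nonpos_of_nonpos_of_nonneg this hu0))

/-! ### Comparison principle and the order of magnitude of `p(n)`. -/

/-- As `σ(k) ≥ 0`, an inequality between a subsolution and a supersolution propagates by strong
induction. The constant only has to cover the finitely many initial ratios, so their sum will do. -/
theorem exists_le_mul_of_sigma_recurrence {a b : ℕ → ℝ} {n₁ : ℕ} (ha : ∀ n, 0 < a n)
    (hb : ∀ n, 0 < b n)
    (h1 : ∀ n, n₁ ≤ n → (n : ℝ) * a n ≤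
      ∑ k ∈ Finset.Icc 1 n, (ArithmeticFunction.sigma 1 k : ℝ) * a (n - k))
    (h2 : ∀ n, n₁ ≤ n → ∑ k ∈ Finset.Icc 1 n, (ArithmeticFunction.sigma 1 k : ℝ) * b (n - k) ≤
      (n : ℝ) * b n) :
    ∃ C : ℝ, 0 < C ∧ ∀ n, a n ≤ C * b n := by
  have hpos : ∀ m, 0 < a m / b m := fun m => div_pos (ha m) (hb m)
  refine ⟨∑ m ∈ Finset.range (n₁ + 1), a m / b m,
    Finset.sum_pos (fun m _ => hpos m) ⟨0, by simp⟩, fun n => ?_⟩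
  set C := ∑ m ∈ Finset.range (n₁ + 1), a m / b m with hC
  induction n using Nat.strong_induction_on with
  | _ n ih =>
    rcases lt_or_ge n (n₁ + 1) with h | h
    · rw [← div_le_iff₀ (hb n)]
      exact Finset.single_le_sum (f := fun m => a m / b m) (fun m _ => (hpos m).le)
        (Finset.mem_range.2 h)
    · have hn : (0 : ℝ) < n := by
        have : 0 < n := by omega
        exact_mod_cast this
      have hC0 : 0 ≤ C := Finset.sum_nonneg fun m _ => (hpos m).le
      refine le_of_mul_le_mul_left ?_ hn
      calc (n : ℝ) * a n ≤ ∑ k ∈ Finset.Icc 1 n, (ArithmeticFunction.sigma 1 k : ℝ) * a (n - k) :=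
            h1 n (by omega)
        _ ≤ ∑ k ∈ Finset.Icc 1 n, C * ((ArithmeticFunction.sigma 1 k : ℝ) * b (n - k)) := by
            refine Finset.sum_le_sum fun k hk => ?_
            have hk := Finset.mem_Icc.1 hk
            have := mul_le_mul_of_nonneg_left (ih (n - k) (by omega))
              (show (0 : ℝ) ≤ (ArithmeticFunction.sigma 1 k : ℝ) by positivity)
            linarith
        _ = C * ∑ k ∈ Finset.Icc 1 n, (ArithmeticFunction.sigma 1 k : ℝ) * b (n - k) := by
            rw [Finset.mul_sum]
        _ ≤ C * (n * b n) := mul_le_mul_of_nonneg_left (h2 n (by omega)) hC0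
        _ = _ := by ring

/-- The perturbation `(n + 2) ^ (-1/4)`. -/
noncomputable def quarterInv (n : ℕ) : ℝ := 1 / Real.sqrt (Real.sqrt (n + 2))

theorem quarterInv_pos (n : ℕ) : 0 < quarterInv n := by
  unfold quarterInv
  positivity

/-- Strictness, including at `n = 0`, keeps `1 - quarterInv n` positive; the shift by two secures
it. -/
theorem quarterInv_lt_one (n : ℕ) : quarterInv n < 1 := by
  have h : (1 : ℝ) < n + 2 := by
    have : (0 : ℝ) ≤ n := by positivity
    linarith
  have h1 : 1 < Real.sqrt (n + 2) := by
    rw [Real.lt_sqrt (by norm_num)]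
    linarith
  rw [quarterInv, div_lt_one (by positivity), Real.lt_sqrt (by norm_num)]
  linarith

theorem sqrt_one_sub_le_one_sub_half {u : ℝ} (h1 : u ≤ 1) :
    Real.sqrt (1 - u) ≤ 1 - u / 2 := by
  rw [Real.sqrt_le_left (by linarith)]
  linarith [sq_nonneg u]

/-- This is `(1 - u) ^ (-1/4) ≥ 1 + u / 4`; the linear term is the source of the gain in the
recurrence. -/
theorem mul_quarterInv_le {n k : ℕ} (hk : k ≤ n) :
    quarterInv n * (1 + (k : ℝ) / (n + 2) / 4) ≤ quarterInv (n - k) := by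
  obtain ⟨p0, p1, -⟩ := ratio_param (n := n) rfl hk
  have h1 : ((n - k : ℕ) : ℝ) + 2 = (n + 2) * (1 - (k : ℝ) / (n + 2)) := by
    rw [Nat.cast_sub hk]
    field_simp
    ring
  set u := (k : ℝ) / (n + 2)
  have h1u : 0 < 1 - u := by linarith
  have h2 : Real.sqrt (Real.sqrt (1 - u)) ≤ 1 - u / 4 := by
    calc _ ≤ Real.sqrt (1 - u / 2) := Real.sqrt_le_sqrt (sqrt_one_sub_le_one_sub_half p1.le)
      _ ≤ 1 - u / 2 / 2 := sqrt_one_sub_le_one_sub_half (by linarith)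
      _ = _ := by ring
  rw [quarterInv, quarterInv, h1, Real.sqrt_mul (by positivity), Real.sqrt_mul (by positivity),
    ← one_div_mul_one_div]
  refine mul_le_mul_of_nonneg_left ?_ (by positivity)
  rw [le_div_iff₀ (by positivity)]
  calc _ ≤ (1 + u / 4) * (1 - u / 4) := mul_le_mul_of_nonneg_left h2 (by positivity)
    _ ≤ 1 := by linarith [sq_nonneg u]

theorem exists_forall_le_sqrt_sqrt (M : ℝ) :
    ∃ n₁ : ℕ, ∀ n, n₁ ≤ n → M ≤ Real.sqrt (Real.sqrt ((n : ℝ) + 2)) := by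
  have h : Filter.Tendsto (fun n : ℕ => Real.sqrt (Real.sqrt ((n : ℝ) + 2))) Filter.atTop
      Filter.atTop :=
    Real.tendsto_sqrt_atTop.comp (Real.tendsto_sqrt_atTop.comp
      (Filter.tendsto_atTop_add_const_right _ _ tendsto_natCast_atTop_atTop))
  exact Filter.eventually_atTop.1 (h.eventually_ge_atTop M)

theorem sum_sigma_hrFun_mul_one_add (n : ℕ) (p q : ℝ) :
    ∑ k ∈ Finset.Icc 1 n, (ArithmeticFunction.sigma 1 k : ℝ) *
      (hrFun (n - k) * (p + q * (1 + (k : ℝ) / (n + 2) / 4))) =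
    hrFun n * ((p + q) * (∑ k ∈ Finset.Icc 1 n, (ArithmeticFunction.sigma 1 k : ℝ) *
        (hrFun (n - k) / hrFun n)) +
      q / 4 * ∑ k ∈ Finset.Icc 1 n, (ArithmeticFunction.sigma 1 k : ℝ) *
        (hrFun (n - k) / hrFun n * ((k : ℝ) / (n + 2)))) := by
  rw [Finset.mul_sum, Finset.mul_sum, ← Finset.sum_add_distrib, Finset.mul_sum]
  refine Finset.sum_congr rfl fun k _ => ?_
  have := (hrFun_pos n).ne'
  field_simp
  ring

/-- With `r = (n + 2) ^ (1/4)`, the perturbation `1 / r` gains `(1 / (4 * r)) * (4 * r ^ 2 / c) = r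
/ c`, where `c` = `hrConst`. This is unbounded and so eventually outweighs the bounded defect of
`hrFun`. The subsolution works the same way with the opposite sign. -/
theorem exists_sigma_supersolution : ∃ n₁ : ℕ, ∀ n, n₁ ≤ n →
    ∑ k ∈ Finset.Icc 1 n, (ArithmeticFunction.sigma 1 k : ℝ) *
      (hrFun (n - k) * (1 - quarterInv (n - k))) ≤ n * (hrFun n * (1 - quarterInv n)) := by
  obtain ⟨K, hK, hA⟩ := exists_sum_sigma_ratio_le
  obtain ⟨K', hK', hB⟩ := exists_le_sum_sigma_ratio_mul
  have hc := hrConst_pos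
  obtain ⟨n₁, hn₁⟩ := exists_forall_le_sqrt_sqrt (3 + hrConst * (2 + K + K'))
  refine ⟨n₁, fun n hn => ?_⟩
  have hM := hn₁ n hn
  set r := Real.sqrt (Real.sqrt ((n : ℝ) + 2)) with hr
  have hr3 : 3 ≤ r := by
    have : 0 < hrConst * (2 + K + K') := by positivity
    linarith
  have hr2 : Real.sqrt ((n : ℝ) + 2) = r ^ 2 := by rw [hr, Real.sq_sqrt (by positivity)]
  have hy : 3 ≤ Real.sqrt ((n : ℝ) + 2) := by rw [hr2]; nlinarith
  have a1 := hA n hy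
  have b1 := hB n hy
  have hq : quarterInv n = 1 / r := rfl
  have hq0 := quarterInv_pos n
  have hq1 := quarterInv_lt_one n
  calc _ ≤ ∑ k ∈ Finset.Icc 1 n, (ArithmeticFunction.sigma 1 k : ℝ) *
      (hrFun (n - k) * (1 + -quarterInv n * (1 + (k : ℝ) / (n + 2) / 4))) := by
        refine Finset.sum_le_sum fun k hk => ?_
        have h := mul_quarterInv_le (Finset.mem_Icc.1 hk).2
        have := hrFun_pos (n - k)
        gcongr
        linarith
    _ ≤ n * (hrFun n * (1 - quarterInv n)) := by
        rw [sum_sigma_hrFun_mul_one_add]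
        have h1 := mul_le_mul_of_nonneg_left a1 (show 0 ≤ 1 + -quarterInv n by linarith)
        have h2 := mul_le_mul_of_nonneg_left b1 (show 0 ≤ quarterInv n / 4 by positivity)
        have h3 : quarterInv n / 4 * (4 * Real.sqrt (n + 2) / hrConst - K') =
            r / hrConst - quarterInv n * K' / 4 := by
          rw [hr2, hq]; field_simp
        have h4 : quarterInv n * K' ≤ K' := mul_le_of_le_one_left hK'.le hq1.le
        have h5 : 2 + K + K' ≤ r / hrConst := by
          rw [le_div_iff₀ hc]
          linarith
        have h6 : (1 + -quarterInv n) * (2 + K) ≤ 2 + K :=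
          mul_le_of_le_one_left (by positivity) (by linarith)
        have h7 := hrFun_pos n
        calc _ ≤ hrFun n * (n * (1 - quarterInv n)) := by
              gcongr
              linarith
          _ = _ := by ring

theorem exists_sigma_subsolution : ∃ n₁ : ℕ, ∀ n, n₁ ≤ n →
    n * (hrFun n * (1 + quarterInv n)) ≤
    ∑ k ∈ Finset.Icc 1 n, (ArithmeticFunction.sigma 1 k : ℝ) *
      (hrFun (n - k) * (1 + quarterInv (n - k))) := by
  obtain ⟨K, hK, hA⟩ := exists_le_sum_sigma_ratio
  obtain ⟨K', hK', hB⟩ := exists_le_sum_sigma_ratio_mul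
  have hc := hrConst_pos
  obtain ⟨n₁, hn₁⟩ := exists_forall_le_sqrt_sqrt (3 + hrConst * (2 * K + K'))
  refine ⟨n₁, fun n hn => ?_⟩
  have hM := hn₁ n hn
  set r := Real.sqrt (Real.sqrt ((n : ℝ) + 2)) with hr
  have hr3 : 3 ≤ r := by
    have : 0 < hrConst * (2 * K + K') := by positivity
    linarith
  have hr2 : Real.sqrt ((n : ℝ) + 2) = r ^ 2 := by rw [hr, Real.sq_sqrt (by positivity)]
  have hy : 3 ≤ Real.sqrt ((n : ℝ) + 2) := by rw [hr2]; nlinarith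
  have a1 := hA n hy
  have b1 := hB n hy
  have hq : quarterInv n = 1 / r := rfl
  have hq0 := quarterInv_pos n
  have hq1 := quarterInv_lt_one n
  calc n * (hrFun n * (1 + quarterInv n)) ≤ ∑ k ∈ Finset.Icc 1 n,
      (ArithmeticFunction.sigma 1 k : ℝ) *
      (hrFun (n - k) * (1 + quarterInv n * (1 + (k : ℝ) / (n + 2) / 4))) := by
        rw [sum_sigma_hrFun_mul_one_add]
        have h1 := mul_le_mul_of_nonneg_left a1 (show 0 ≤ 1 + quarterInv n by linarith)
        have h2 := mul_le_mul_of_nonneg_left b1 (show 0 ≤ quarterInv n / 4 by positivity)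
        have h3 : quarterInv n / 4 * (4 * Real.sqrt (n + 2) / hrConst - K') =
            r / hrConst - quarterInv n * K' / 4 := by
          rw [hr2, hq]; field_simp
        have h4 : quarterInv n * K' ≤ K' := mul_le_of_le_one_left hK'.le hq1.le
        have h5 : 2 * K + K' ≤ r / hrConst := by
          rw [le_div_iff₀ hc]
          linarith
        have h6 : quarterInv n * K ≤ K := mul_le_of_le_one_left hK.le hq1.le
        have h7 := hrFun_pos n
        calc _ = hrFun n * (n * (1 + quarterInv n)) := by ring
          _ ≤ _ := by
              gcongr
              linarith
    _ ≤ _ := by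
        refine Finset.sum_le_sum fun k hk => ?_
        have h := mul_quarterInv_le (Finset.mem_Icc.1 hk).2
        have := hrFun_pos (n - k)
        gcongr

theorem cast_mul_partitionCount (n : ℕ) : (n : ℝ) * partitionCount n =
    ∑ k ∈ Finset.Icc 1 n, (ArithmeticFunction.sigma 1 k : ℝ) * (partitionCount (n - k) : ℝ) := by
  exact_mod_cast mul_partitionCount n

theorem exists_partitionCount_le : ∃ C : ℝ, 0 < C ∧ ∀ n,
    (partitionCount n : ℝ) ≤ C * hrFun n := by
  obtain ⟨n₁, h⟩ := exists_sigma_supersolution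
  obtain ⟨C, hC, hle⟩ := exists_le_mul_of_sigma_recurrence (n₁ := n₁)
    (a := fun n => (partitionCount n : ℝ)) (b := fun n => hrFun n * (1 - quarterInv n))
    (fun n => by exact_mod_cast partitionCount_pos n)
    (fun n => mul_pos (hrFun_pos n) (sub_pos.2 (quarterInv_lt_one n)))
    (fun n _ => (cast_mul_partitionCount n).le) h
  refine ⟨C, hC, fun n => (hle n).trans ?_⟩
  gcongr
  exact mul_le_of_le_one_right (hrFun_pos n).le (by linarith [quarterInv_pos n])

theorem exists_hrFun_le : ∃ C : ℝ, 0 < C ∧ ∀ n, hrFun n ≤ C * (partitionCount n : ℝ) := by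
  obtain ⟨n₁, h⟩ := exists_sigma_subsolution
  obtain ⟨C, hC, hle⟩ := exists_le_mul_of_sigma_recurrence (n₁ := n₁)
    (a := fun n => hrFun n * (1 + quarterInv n)) (b := fun n => (partitionCount n : ℝ))
    (fun n => mul_pos (hrFun_pos n) (by linarith [quarterInv_pos n]))
    (fun n => by exact_mod_cast partitionCount_pos n) h
    (fun n _ => (cast_mul_partitionCount n).ge)
  refine ⟨C, hC, fun n => le_trans ?_ (hle n)⟩
  exact le_mul_of_one_le_right (hrFun_pos n).le (by linarith [quarterInv_pos n])

/-! ### The ratio `p(n - t) / p(n)` and the conclusion. -/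

/-- `p(n - t) / p(n)` is at most a constant times `exp (-π t / √(6 n))`. -/
theorem exists_partitionCount_sub_le : ∃ C : ℝ, 0 < C ∧ ∀ n t : ℕ, 1 ≤ n → t ≤ n →
    (partitionCount (n - t) : ℝ) ≤
      C * (partitionCount n * Real.exp (-(hrConst / (2 * Real.sqrt n) * t))) := by
  obtain ⟨C₁, hC₁, h₁⟩ := exists_partitionCount_le
  obtain ⟨C₂, hC₂, h₂⟩ := exists_hrFun_le
  have hc := hrConst_pos
  have hc3 := hrConst_le_three
  set K := 2 + 2 * 32 ^ 2 / hrConst ^ 2 with hK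
  have hK0 : 0 < K := by positivity
  refine ⟨C₁ * C₂ * K * Real.exp 3, by positivity, fun n t hn ht => ?_⟩
  have hn' : (1 : ℝ) ≤ n := by exact_mod_cast hn
  have ht' : (t : ℝ) ≤ n := by exact_mod_cast ht
  set y := Real.sqrt ((n : ℝ) + 2) with hy
  set z := Real.sqrt (n : ℝ) with hz
  have hz2 : z ^ 2 = n := Real.sq_sqrt (by positivity)
  have hy2 : y ^ 2 = n + 2 := Real.sq_sqrt (by positivity)
  have hz1 : 1 ≤ z := by rw [hz, Real.one_le_sqrt]; exact hn'
  have hzy : z ≤ y := Real.sqrt_le_sqrt (by linarith)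
  have hy0 : 0 < y := by linarith
  have hyz : y ≤ z + 1 := by
    rw [hy]
    apply Real.sqrt_le_iff.2
    constructor <;> nlinarith
  obtain ⟨p0, p1, p2⟩ := ratio_param hy ht
  have h3 := exp_sqrt_ratio_le hy0 p0 p1 p2
  rw [← hrFun_ratio ht hy rfl, div_le_iff₀ (hrFun_pos n)] at h3
  -- Undoing the shift by two changes `t / √n` by at most `1`, hence the exponent by at most
  -- `hrConst / 2`; `exp 3` is a generous allowance.
  have h4 : Real.exp (-(hrConst * y * ((t : ℝ) / (n + 2)) / 2)) ≤
      Real.exp 3 * Real.exp (-(hrConst / (2 * z) * t)) := by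
    rw [← Real.exp_add]
    apply Real.exp_le_exp.2
    have e1 : hrConst * y * ((t : ℝ) / (n + 2)) / 2 = hrConst / 2 * (t / y) := by
      rw [← hy2]
      field_simp
    have e2 : hrConst / (2 * z) * t = hrConst / 2 * (t / z) := by field_simp
    have e3 : (t : ℝ) / z ≤ t / y + 1 := by
      have hz0 : 0 < z := by linarith
      rw [div_add_one hy0.ne', div_le_div_iff₀ hz0 hy0]
      have : (t : ℝ) ≤ z * y := by nlinarith
      nlinarith [mul_le_mul_of_nonneg_left hyz (Nat.cast_nonneg (α := ℝ) t)]
    have e4 := mul_le_mul_of_nonneg_left e3 (show 0 ≤ hrConst / 2 by positivity)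
    rw [e1, e2]
    linarith
  have hp := h₂ n
  calc (partitionCount (n - t) : ℝ) ≤ C₁ * hrFun (n - t) := h₁ _
    _ ≤ C₁ * (K * Real.exp (-(hrConst * y * ((t : ℝ) / (n + 2)) / 2)) * hrFun n) := by gcongr
    _ ≤ C₁ * (K * (Real.exp 3 * Real.exp (-(hrConst / (2 * z) * t))) *
          (C₂ * partitionCount n)) := by
        have := hrFun_pos n
        gcongr
    _ = _ := by ring

theorem mul_exp_neg_mul_le {a t t₀ : ℝ} (ht₀ : 0 < t₀) (h : 1 ≤ a * t₀) (ht : t₀ ≤ t) :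
    t * Real.exp (-(a * t)) ≤ t₀ * Real.exp (-(a * t₀)) := by
  have h1 : t ≤ t₀ * Real.exp (a * (t - t₀)) := by
    have h2 := mul_le_mul_of_nonneg_left (Real.add_one_le_exp (a * (t - t₀))) ht₀.le
    have h3 := mul_le_mul_of_nonneg_right h (sub_nonneg.2 ht)
    linarith
  calc t * Real.exp (-(a * t)) ≤ t₀ * Real.exp (a * (t - t₀)) * Real.exp (-(a * t)) := by gcongr
    _ = t₀ * Real.exp (-(a * t₀)) := by
        rw [mul_assoc, ← Real.exp_add]
        ring_nf

theorem mainTheorem6 :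
    ∃ C : ℝ, 0 < C ∧
      ∀ (n : ℕ), 3 ≤ n →
      ∀ (L : ℝ), 1 ≤ L → L ≤ Real.log (n : ℝ) / Real.log (Real.log (n : ℝ)) →
      ∀ (t : ℕ),
        (1 + 1 / L) * (Real.sqrt 6 / (2 * Real.pi)) * Real.sqrt (n : ℝ) * Real.log (n : ℝ)
          ≤ (t : ℝ) →
        (nonCoreCount t n : ℝ)
          ≤ C * ((partitionCount n : ℝ) *
              (Real.log (n : ℝ) / (n : ℝ) ^ (1 / (2 * L)))) := by
  obtain ⟨C, hC, hp⟩ := exists_partitionCount_sub_le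
  refine ⟨Real.exp 3 + 8 * C, by positivity, fun n hn L hL _ t ht => ?_⟩
  have hn3 : (3 : ℝ) ≤ n := by exact_mod_cast hn
  have hn0 : (0 : ℝ) < n := by linarith
  have hL0 : 0 < L := by linarith
  have hlog1 : 1 ≤ Real.log n := by
    rw [Real.le_log_iff_exp_le hn0]
    linarith [Real.exp_one_lt_three]
  have hpn : (0 : ℝ) < partitionCount n := by exact_mod_cast partitionCount_pos n
  have hpow : 0 < (n : ℝ) ^ (1 / (2 * L)) := Real.rpow_pos_of_pos hn0 _
  set Q := (partitionCount n : ℝ) * (Real.log n / (n : ℝ) ^ (1 / (2 * L))) with hQ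
  have hQ0 : 0 < Q := by positivity
  -- For `log n < 3` the trivial bound by `p(n)` suffices, with constant `exp 3 > n ≥ n ^ (1 / (2
  -- L))`. Otherwise `log n ≥ 3` and `κ * 3 ≥ 1` give `t ≥ √n`, as `nonCoreCount_le` needs.
  rcases lt_or_ge (Real.log n) 3 with hsmall | hlarge
  · have h1 : (nonCoreCount t n : ℝ) ≤ partitionCount n := by
      exact_mod_cast nonCoreCount_le_partitionCount t n
    have h2 : (n : ℝ) ^ (1 / (2 * L)) ≤ n := by
      conv_rhs => rw [← Real.rpow_one (n : ℝ)]
      apply Real.rpow_le_rpow_of_exponent_le (by linarith)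
      rw [div_le_one (by positivity)]
      linarith
    have h3 : (n : ℝ) ≤ Real.exp 3 := ((Real.log_lt_iff_lt_exp hn0).1 hsmall).le
    have h4 : 1 ≤ Real.exp 3 * (Real.log n / (n : ℝ) ^ (1 / (2 * L))) := by
      rw [← mul_div_assoc, le_div_iff₀ hpow]
      nlinarith [Real.exp_pos 3]
    calc (nonCoreCount t n : ℝ) ≤ partitionCount n * 1 := by linarith
      _ ≤ partitionCount n * (Real.exp 3 * (Real.log n / (n : ℝ) ^ (1 / (2 * L)))) := by gcongr
      _ = Real.exp 3 * Q := by ring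
      _ ≤ (Real.exp 3 + 8 * C) * Q := by
          gcongr
          linarith
  rcases lt_or_ge n t with htn | htn
  · rw [nonCoreCount_eq_zero htn]
    have := Real.exp_pos 3
    simp only [Nat.cast_zero]
    positivity
  set z := Real.sqrt (n : ℝ) with hz
  have hz0 : 0 < z := Real.sqrt_pos.2 hn0
  have hz2 : z ^ 2 = n := Real.sq_sqrt hn0.le
  have hpi := Real.pi_pos
  set κ := Real.sqrt 6 / (2 * Real.pi) with hκ
  have hκ1 : 1 ≤ κ * 3 := by
    have h6 : (2.4 : ℝ) ≤ Real.sqrt 6 := Real.le_sqrt_of_sq_le (by norm_num)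
    have := Real.pi_lt_d2
    rw [hκ, div_mul_eq_mul_div, le_div_iff₀ (by positivity)]
    linarith
  have hκ2 : κ ≤ 1 := by
    have h6 : Real.sqrt 6 ≤ 3 := Real.sqrt_le_iff.2 (by norm_num)
    have := Real.pi_gt_three
    rw [hκ, div_le_one (by positivity)]
    linarith
  have hκ0 : 0 < κ := by linarith
  have hcκ : hrConst * κ = 1 := by
    have h1 : Real.sqrt (2 / 3) * Real.sqrt 6 = 2 := by
      rw [← Real.sqrt_mul (by norm_num), Real.sqrt_eq_iff_mul_self_eq (by norm_num) (by norm_num)]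
      norm_num
    rw [hrConst, hκ]
    calc _ = (Real.sqrt (2 / 3) * Real.sqrt 6) / 2 := by field_simp
      _ = 1 := by rw [h1]; norm_num
  set t₀ := (1 + 1 / L) * κ * z * Real.log n with ht₀
  have hL1 : 0 < 1 / L := by positivity
  have hL2 : 1 / L ≤ 1 := by rw [div_le_one hL0]; exact hL
  have ht₀0 : 0 < t₀ := by positivity
  have hzt : z ≤ t := by
    refine le_trans ?_ ht
    have h1 : κ * 3 ≤ κ * Real.log n := by gcongr
    have h2 : κ * Real.log n ≤ (1 + 1 / L) * (κ * Real.log n) :=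
      le_mul_of_one_le_left (by positivity) (by linarith)
    calc z = z * 1 := by ring
      _ ≤ z * ((1 + 1 / L) * (κ * Real.log n)) := by gcongr; linarith
      _ = t₀ := by rw [ht₀]; ring
  have hnt : n < (t + 1) ^ 2 := by
    have : (n : ℝ) < ((t : ℝ) + 1) ^ 2 := by rw [← hz2]; gcongr; linarith
    exact_mod_cast this
  -- The constant `√6 / (2 π)` is exactly `1 / hrConst`. The first term of the exponent yields `n ^
  -- (-1/2)`, cancelling the `√n` in `t₀`; the second yields the saving `n ^ (-1 / (2 L))`.
  have hat : hrConst / (2 * z) * t₀ = Real.log n / 2 + Real.log n * (1 / (2 * L)) := by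
    calc _ = (hrConst * κ) * ((1 + 1 / L) * Real.log n / 2) := by
          rw [ht₀]
          field_simp
      _ = _ := by rw [hcκ]; field_simp
  have hlogL : 0 < Real.log n * (1 / (2 * L)) := by positivity
  have h1 := mul_exp_neg_mul_le (a := hrConst / (2 * z)) ht₀0 (by rw [hat]; linarith) ht
  have h2 : t₀ * Real.exp (-(hrConst / (2 * z) * t₀)) ≤
      2 * (Real.log n / (n : ℝ) ^ (1 / (2 * L))) := by
    have e1 : Real.exp (-(hrConst / (2 * z) * t₀)) = 1 / z * (1 / (n : ℝ) ^ (1 / (2 * L))) := by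
      rw [hat, neg_add, Real.exp_add, Real.rpow_def_of_pos hn0, Real.exp_neg, Real.exp_neg,
        Real.exp_half, Real.exp_log hn0, one_div z, one_div (Real.exp _)]
    have e2 : (1 + 1 / L) * κ ≤ 2 := by nlinarith
    calc _ = (1 + 1 / L) * κ * (Real.log n / (n : ℝ) ^ (1 / (2 * L))) := by
          rw [e1, ht₀]
          field_simp
      _ ≤ _ := by gcongr
  have h3 : (nonCoreCount t n : ℝ) ≤ 4 * t * partitionCount (n - t) := by
    exact_mod_cast nonCoreCount_le hnt
  calc (nonCoreCount t n : ℝ) ≤ 4 * t * partitionCount (n - t) := h3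
    _ ≤ 4 * t * (C * (partitionCount n * Real.exp (-(hrConst / (2 * z) * t)))) := by
        gcongr
        exact hp n t (by omega) htn
    _ = 4 * C * partitionCount n * (t * Real.exp (-(hrConst / (2 * z) * t))) := by ring
    _ ≤ 4 * C * partitionCount n * (2 * (Real.log n / (n : ℝ) ^ (1 / (2 * L)))) := by
        exact mul_le_mul_of_nonneg_left (h1.trans h2) (by positivity)
    _ = 8 * C * Q := by rw [hQ]; ring
    _ ≤ (Real.exp 3 + 8 * C) * Q := by
        gcongr
        linarith [Real.exp_pos 3]
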